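/- Let $p\in(0,1)$, $q=1-p$ and $H=-p\ln p-q\ln q$. Consider independent random infinite strings $\Xi^{(0)},\Xi^{(1)},\Xi^{(2)},\dots$ over the alphabet $\{0,1\}$ whose letters are i.i.d. with $\mathbb P(1)=p$ and $\mathbb P(0)=q$. The trie of a finite set of strings is the binary tree defined recursively as follows: the trie of the empty set is empty; the trie of a single string is one node (external); the trie of at least two strings has an internal root, whose left and right subtrees are the tries, constructed from the remaining letters, of the strings that begin with $0$ and with $1$, respectively. Let $N_n$ be the number of new internal nodes (nodes that are internal after the insertion but not before it) when $\Xi^{(0)}$ is inserted into the trie of $\Xi^{(1)},\dots,\Xi^{(n)}$. In the Poisson model, let $\widetilde N_\lambda=N_{M_\lambda}$, where $M_\lambda$ has the Poisson distribution with mean $\lambda$ and is independent of the strings. Define $\psi:\mathbb R\to\mathbb R$ as follows. If $\ln p/\ln q$ is irrational, then $\psi=0$. If $\ln p/\ln q$ is rational, let $d=\gcd(\ln p,\ln q)$, the largest positive real number such that $\ln p$ and $\ln q$ both are integer multiples of $d$ (it exists), and let $$\psi(t)=\frac{2pq}{H}\sum_{k\in\mathbb Z,\ k\ne0}\Gamma\Bigl(1-\frac{2\pi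 i k}{d}\Bigr)e^{2\pi i k t/d},$$ where the series converges (unconditionally) to a real number for every real $t$. **Theorem.** As $n\to\infty$, $$\mathbb P(N_n=0)=1-\frac{2pq}{H}-\psi(\ln n)+o(1),$$ $$\mathbb P(N_n=j)=\Bigl(\frac{2pq}{H}+\psi(\ln n)\Bigr)2pq(1-2pq)^{j-1}+o(1)\qquad\text{for every fixed } j\ge1.$$ Further, $N_n$ has finite mean for every $n$, and $$\mathbb E N_n=\frac1H+\frac{1}{2pq}\psi(\ln n)+o(1).$$ The same results hold for $\widetilde N_\lambda$ as the real parameter $\lambda\to\infty$, with $n$ replaced by $\lambda$. -/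

import Mathlib

open MeasureTheory ProbabilityTheory Filter Topology
open scoped NNReal

namespace RandomTrie

/-- An infinite string over the alphabet `{0, 1}` (`false` is the letter 0, `true` the letter 1). -/
abbrev BitString : Type := ℕ → Bool

/-- The strings passed to the subtree of the root with label `b`: those strings of `S` that begin
with `b`, with this first letter removed (so that the subtree is built by the same procedure from
the remaining letters). -/
def branch (b : Bool) (S : Set BitString) : Set BitString :=
  {s | ∃ t ∈ S, t 0 = b ∧ s = fun i => t (i + 1)}

/-- What a trie has at a given node of the infinite binary tree. -/
inductive NodeKind : Type
  | absent
  | external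
  | internal

open Classical in
/-- The trie of a set `S` of strings, as a labelling of the nodes of the complete infinite binary
tree (a node is the finite string of letters on the path to it from the root). If `S` is empty, the
trie is empty; if `S` has one element, the trie is a single external node (the root); if `S` has at
least two elements, the root is internal, and its two subtrees are the tries of the strings that
begin with 0 and with 1. -/
noncomputable def trie (S : Set BitString) : List Bool → NodeKind
  | [] =>
    if S = ∅ then NodeKind.absent
    else if S.Nontrivial then NodeKind.internal
    else NodeKind.external
  | b :: a => if S.Nontrivial then trie (branch b S) a else NodeKind.absent

/-- The number of new internal nodes when the string `s` is inserted into the trie of `S`: the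
number of nodes that are internal in the new trie but not in the old one. -/
noncomputable def newInternalNodes (S : Set BitString) (s : BitString) : ℕ :=
  Set.ncard {a : List Bool |
    trie (insert s S) a = NodeKind.internal ∧ trie S a ≠ NodeKind.internal}

/-- The number of new internal nodes when the string numbered `0` of the family `x` is inserted
into the trie of the `n` strings numbered `1, …, n`. -/
noncomputable def insertionCount (x : ℕ → BitString) (n : ℕ) : ℕ :=
  newInternalNodes {s | ∃ i, 1 ≤ i ∧ i ≤ n ∧ s = x i} (x 0)

/-- The positive real numbers `d` such that `x` and `y` both are integer multiples of `d`. Its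
greatest element, if there is one, is the real greatest common divisor of `x` and `y`. -/
def commonDivisors (x y : ℝ) : Set ℝ :=
  {d | 0 < d ∧ (∃ a : ℤ, x = a * d) ∧ ∃ b : ℤ, y = b * d}

/-- The function `ψ` is the oscillating term for letter probabilities `p` and `q`, where `H` is the
entropy of a letter: it vanishes if `log p / log q` is irrational; otherwise
`ψ t = (2 p q / H) ∑_{k ≠ 0} Γ(1 - 2 π i k / d) exp (2 π i k t / d)`, a convergent series, where
`d = gcd (log p, log q)`. -/
def IsOscillation (p q H : ℝ) (ψ : ℝ → ℝ) : Prop :=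
  (Irrational (Real.log p / Real.log q) → ∀ t, ψ t = 0) ∧
  (¬ Irrational (Real.log p / Real.log q) →
    ∃ d : ℝ, IsGreatest (commonDivisors (Real.log p) (Real.log q)) d ∧
      ∀ t : ℝ, HasSum
        (fun k : {k : ℤ // k ≠ 0} =>
          (2 * p * q / H : ℂ) * (Complex.Gamma (1 - 2 * Real.pi * Complex.I * (k : ℤ) / d) *
            Complex.exp (2 * Real.pi * Complex.I * (k : ℤ) * t / d)))
        (ψ t : ℂ))

/-- The asymptotics, along `l`, of a family `N` of natural-number valued random variables, with
respect to a parameter `r`: `N` has finite mean,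
`P(N = 0) = 1 - 2 p q / H - ψ(log r) + o(1)`,
`P(N = j) = (2 p q / H + ψ(log r)) 2 p q (1 - 2 p q)^(j - 1) + o(1)` for every fixed `j ≥ 1`, and
`E N = 1 / H + ψ(log r) / (2 p q) + o(1)`. -/
def InsertionAsymptotics {Ω ι : Type*} [MeasurableSpace Ω] (P : Measure Ω) (p q H : ℝ)
    (ψ : ℝ → ℝ) (l : Filter ι) (r : ι → ℝ) (N : ι → Ω → ℕ) : Prop :=
  Tendsto (fun n => P.real {ω | N n ω = 0} - (1 - 2 * p * q / H - ψ (Real.log (r n)))) l (𝓝 0) ∧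
  (∀ j : ℕ, 1 ≤ j →
    Tendsto (fun n => P.real {ω | N n ω = j} -
      (2 * p * q / H + ψ (Real.log (r n))) * (2 * p * q) * (1 - 2 * p * q) ^ (j - 1)) l (𝓝 0)) ∧
  (∀ n, Integrable (fun ω => (N n ω : ℝ)) P) ∧
  Tendsto (fun n => (∫ ω, (N n ω : ℝ) ∂P) - (1 / H + ψ (Real.log (r n)) / (2 * p * q))) l (𝓝 0)

end RandomTrie

namespace RandomTrie

/-! A node is internal iff at least two strings pass through it, so the new internal nodes are the
prefixes of the inserted string, of those lengths k at which exactly one other string agrees with it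
(`insertionCount_eq_ncard`). A match at level k + j is a match at level k, so unique matches at both
levels are by the same string (`uniqueMatch_and_iff`). Hence these levels form an interval, the
number of k with both k and k + j in it is (N - j)⁺, and the j further letters agree with
probability r^j, where r = p² + q² = 1 - 2pq. This gives E(N - j)⁺ = r^j E N for every j, and
differences in j express the whole law of N through E N. Only the mean needs asymptotics.

Summing over words, the probability that k is such a level is the k-th iterate of `average` applied
to an explicit kernel. In the Poisson model the kernel is x e^{-x}, so the mean g satisfies g(x) = x
e^{-x} + p g(px) + q g(qx). In t = log x this is a renewal equation with steps -log p and -log q, of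
mean H. The mean for fixed n differs from it by O(1/n) (`tendsto_fixedMean_sub_poissonMean`).

The renewal theorem is proved by a maximum principle: where a solution is close to its upper limit,
so are its translates by the semigroup generated by the steps. For irrational ratio the semigroup is
asymptotically dense, g is nearly constant on a window, and a primitive of g with known weighted
increments identifies the constant as 1/H (`tendsto_renewal_of_irrational`). For rational ratio, g
minus a multiple of the d-periodization of the kernel has window sums tending to 0, so its upper and
lower limits vanish (`tendsto_renewal_of_lattice`). Poisson summation turns the periodization into
the Gamma series: the term k = 0 gives 1/H, the others give ψ (`hasSum_Gamma_mul_exp`). -/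

/-! ### The averaging operator and its renewal series -/

/-- The expectation of `h (x X)` for a random factor `X` that is `p` with probability `p` and `q`
with probability `q`. -/
noncomputable def average (p q : ℝ) (h : ℝ → ℝ) (x : ℝ) : ℝ := p * h (p * x) + q * h (q * x)

/-- The sum of all iterated averages of `h`. -/
noncomputable def renewalSum (p q : ℝ) (h : ℝ → ℝ) (x : ℝ) : ℝ :=
  ∑' m : ℕ, (average p q)^[m] h x

section Average

variable {p q : ℝ}

lemma average_iterate_succ (m : ℕ) (h : ℝ → ℝ) (x : ℝ) :
    (average p q)^[m + 1] h x
      = p * (average p q)^[m] h (p * x) + q * (average p q)^[m] h (q * x) := by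
  rw [Function.iterate_succ_apply']; rfl

lemma average_iterate_linear (a b : ℝ) (h k : ℝ → ℝ) (m : ℕ) (x : ℝ) :
    (average p q)^[m] (fun y => a * h y + b * k y) x
      = a * (average p q)^[m] h x + b * (average p q)^[m] k x := by
  induction m generalizing x with
  | zero => rfl
  | succ m ih => simp only [average_iterate_succ, ih]; ring

lemma average_iterate_const_mul (a : ℝ) (h : ℝ → ℝ) (m : ℕ) (x : ℝ) :
    (average p q)^[m] (fun y => a * h y) x = a * (average p q)^[m] h x := by
  simpa using average_iterate_linear (p := p) (q := q) a 0 h h m x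

lemma average_iterate_sub (h k : ℝ → ℝ) (m : ℕ) (x : ℝ) :
    (average p q)^[m] (fun y => h y - k y) x
      = (average p q)^[m] h x - (average p q)^[m] k x := by
  simpa [sub_eq_add_neg] using average_iterate_linear (p := p) (q := q) 1 (-1) h k m x

lemma average_iterate_comp_mul (c : ℝ) (h : ℝ → ℝ) (m : ℕ) (x : ℝ) :
    (average p q)^[m] (fun y => h (c * y)) x = (average p q)^[m] h (c * x) := by
  induction m generalizing x with
  | zero => rfl
  | succ m ih => simp only [average_iterate_succ, ih, mul_left_comm]

/-- The identity is an eigenfunction with eigenvalue p² + q² < 1. Every kernel dominated by a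
multiple of it therefore has a geometrically convergent series of iterates. -/
lemma average_iterate_id (m : ℕ) (x : ℝ) :
    (average p q)^[m] (fun y => y) x = (p ^ 2 + q ^ 2) ^ m * x := by
  induction m generalizing x with
  | zero => simp
  | succ m ih => simp only [average_iterate_succ, ih]; ring

lemma average_iterate_hasSum {ι : Type*} {h : ι → ℝ → ℝ} {k : ℝ → ℝ}
    (hk : ∀ x, HasSum (fun i => h i x) (k x)) (m : ℕ) (x : ℝ) :
    HasSum (fun i => (average p q)^[m] (h i) x) ((average p q)^[m] k x) := by
  induction m generalizing x with
  | zero => exact hk x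
  | succ m ih =>
    simp only [average_iterate_succ]
    exact ((ih _).mul_left p).add ((ih _).mul_left q)

variable (hp : 0 < p) (hq : 0 < q) (hpq : p + q = 1)
include hp hq hpq

/-- The iterates at x evaluate the kernel only on [0, x], because p, q ≤ 1. The restriction matters
for the binomial kernel, which is controlled only on [0, 1]. -/
lemma average_iterate_mono {h k : ℝ → ℝ} {x : ℝ} (hx : 0 ≤ x)
    (hk : ∀ y, 0 ≤ y → y ≤ x → h y ≤ k y) (m : ℕ) :
    (average p q)^[m] h x ≤ (average p q)^[m] k x := by
  induction m generalizing x with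
  | zero => exact hk x hx le_rfl
  | succ m ih =>
    simp only [average_iterate_succ]
    have h1 : p * x ≤ x := by nlinarith
    have h2 : q * x ≤ x := by nlinarith
    gcongr
    · exact ih (by positivity) fun y hy hyx => hk y hy (hyx.trans h1)
    · exact ih (by positivity) fun y hy hyx => hk y hy (hyx.trans h2)

lemma average_iterate_nonneg {h : ℝ → ℝ} {x : ℝ} (hx : 0 ≤ x)
    (hh : ∀ y, 0 ≤ y → y ≤ x → 0 ≤ h y) (m : ℕ) : 0 ≤ (average p q)^[m] h x := by
  have h1 := average_iterate_mono hp hq hpq (h := fun y => 0 * y) hx (by simpa using hh) m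
  rw [average_iterate_const_mul] at h1
  simpa using h1

lemma abs_average_iterate_le_average {h k : ℝ → ℝ} {x : ℝ} (hx : 0 ≤ x)
    (hh : ∀ y, 0 ≤ y → y ≤ x → |h y| ≤ k y) (m : ℕ) :
    |(average p q)^[m] h x| ≤ (average p q)^[m] k x := by
  have e : -(average p q)^[m] k x = (average p q)^[m] (fun y => -1 * k y) x := by
    rw [average_iterate_const_mul, neg_one_mul]
  rw [abs_le, e]
  constructor <;> refine average_iterate_mono hp hq hpq hx (fun y h1 h2 => ?_) m
  · have := (abs_le.1 (hh y h1 h2)).1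
    linarith
  · exact (abs_le.1 (hh y h1 h2)).2

lemma abs_average_iterate_le {h : ℝ → ℝ} {x C : ℝ} (hx : 0 ≤ x)
    (hh : ∀ y, 0 ≤ y → y ≤ x → |h y| ≤ C * y) (m : ℕ) :
    |(average p q)^[m] h x| ≤ C * ((p ^ 2 + q ^ 2) ^ m * x) := by
  rw [← average_iterate_id, ← average_iterate_const_mul]
  exact abs_average_iterate_le_average hp hq hpq hx hh m

lemma sq_add_sq_lt_one : p ^ 2 + q ^ 2 < 1 := by nlinarith [mul_pos hp hq]

lemma summable_average_iterate {h : ℝ → ℝ} {x C : ℝ} (hx : 0 ≤ x)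
    (hh : ∀ y, 0 ≤ y → y ≤ x → |h y| ≤ C * y) :
    Summable fun m => (average p q)^[m] h x := by
  refine Summable.of_norm_bounded ?_
    fun m => abs_average_iterate_le hp hq hpq hx hh m
  exact ((summable_geometric_of_lt_one (by positivity)
    (sq_add_sq_lt_one hp hq hpq)).mul_right x).mul_left C

lemma renewalSum_eq {h : ℝ → ℝ} {C : ℝ} (hh : ∀ y, 0 ≤ y → |h y| ≤ C * y) {x : ℝ} (hx : 0 ≤ x) :
    renewalSum p q h x
      = h x + p * renewalSum p q h (p * x) + q * renewalSum p q h (q * x) := by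
  have hs : ∀ y, 0 ≤ y → Summable fun m => (average p q)^[m] h y := fun y hy =>
    summable_average_iterate hp hq hpq hy fun z hz _ => hh z hz
  rw [renewalSum, (hs x hx).tsum_eq_zero_add]
  simp only [average_iterate_succ]
  rw [Summable.tsum_add ((hs _ (by positivity)).mul_left p) ((hs _ (by positivity)).mul_left q),
    tsum_mul_left, tsum_mul_left, ← add_assoc]
  rfl

lemma abs_renewalSum_le {h : ℝ → ℝ} {x C : ℝ} (hx : 0 ≤ x)
    (hh : ∀ y, 0 ≤ y → y ≤ x → |h y| ≤ C * y) :
    |renewalSum p q h x| ≤ C * ((1 - (p ^ 2 + q ^ 2))⁻¹ * x) := by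
  have h1 := sq_add_sq_lt_one hp hq hpq
  refine tsum_of_norm_bounded (f := fun m => (average p q)^[m] h x) ?_
    fun m => abs_average_iterate_le hp hq hpq hx hh m
  exact ((hasSum_geometric_of_lt_one (by positivity) h1).mul_right x).mul_left C

omit hpq in
-- The Euler operator x d/dx commutes with dilations, hence with `average`.
lemma hasDerivAt_average_iterate {h k : ℝ → ℝ} (hh : ∀ y, 0 < y → HasDerivAt h (k y / y) y)
    (m : ℕ) {x : ℝ} (hx : 0 < x) :
    HasDerivAt ((average p q)^[m] h) ((average p q)^[m] k x / x) x := by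
  induction m generalizing x with
  | zero => exact hh x hx
  | succ m ih =>
    have h1 := ((ih (mul_pos hp hx)).comp x ((hasDerivAt_id x).const_mul p)).const_mul p
    have h2 := ((ih (mul_pos hq hx)).comp x ((hasDerivAt_id x).const_mul q)).const_mul q
    have h3 := h1.add h2
    rw [average_iterate_succ]
    have e : (average p q)^[m + 1] h = fun x =>
        p * (average p q)^[m] h (p * x) + q * (average p q)^[m] h (q * x) :=
      funext fun x => average_iterate_succ m h x
    rw [e]
    exact h3.congr_deriv (by field_simp)

lemma hasDerivAt_renewalSum {h k : ℝ → ℝ} {C D : ℝ}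
    (hh : ∀ y, 0 < y → HasDerivAt h (k y / y) y) (hC : ∀ y, 0 ≤ y → |h y| ≤ C * y)
    (hk : ∀ y, 0 ≤ y → |k y| ≤ D * y) {x : ℝ} (hx : 0 < x) :
    HasDerivAt (renewalSum p q h) (renewalSum p q k x / x) x := by
  have h1 := hasDerivAt_tsum_of_isPreconnected (g := fun m => (average p q)^[m] h)
    (g' := fun m y => (average p q)^[m] k y / y) (u := fun m => D * (p ^ 2 + q ^ 2) ^ m)
    (t := Set.Ioi 0) (y₀ := x) (y := x)
    ((summable_geometric_of_lt_one (by positivity) (sq_add_sq_lt_one hp hq hpq)).mul_left D)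
    isOpen_Ioi isPreconnected_Ioi
    (fun m y hy => hasDerivAt_average_iterate hp hq hh m hy) (fun m y hy => ?_) hx
    (summable_average_iterate hp hq hpq hx.le fun y hy _ => hC y hy) hx
  · rw [renewalSum, ← tsum_div_const]
    exact h1
  · have hy : (0 : ℝ) < y := hy
    rw [norm_div, Real.norm_eq_abs, Real.norm_eq_abs, abs_of_pos hy, div_le_iff₀ hy, mul_assoc]
    exact abs_average_iterate_le hp hq hpq hy.le (fun z hz _ => hk z hz) m

end Average

/-! ### The mean number of new internal nodes in the Poisson model -/

/-- The mean number of new internal nodes in the Poisson model, as a function of the parameter. -/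
noncomputable def poissonMean (p q x : ℝ) : ℝ := renewalSum p q (fun y => y * Real.exp (-y)) x

/-- A potential whose logarithmic derivative is `poissonMean`. -/
noncomputable def poissonPotential (p q x : ℝ) : ℝ := renewalSum p q (fun y => 1 - Real.exp (-y)) x

/-- The mean number of new internal nodes when a string is inserted into a trie of `n` strings. -/
noncomputable def fixedMean (p q : ℝ) (n : ℕ) : ℝ :=
  renewalSum p q (fun y => n * (y * (1 - y) ^ (n - 1))) 1

lemma abs_mul_exp_neg_le {y : ℝ} (hy : 0 ≤ y) : |y * Real.exp (-y)| ≤ 1 * y := by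
  rw [abs_of_nonneg (by positivity), mul_comm]
  gcongr
  exact Real.exp_le_one_iff.2 (by linarith)

lemma abs_one_sub_exp_neg_le {y : ℝ} (hy : 0 ≤ y) : |1 - Real.exp (-y)| ≤ 1 * y := by
  have h1 : Real.exp (-y) ≤ 1 := Real.exp_le_one_iff.2 (by linarith)
  have h2 := Real.add_one_le_exp (-y)
  rw [abs_of_nonneg (by linarith)]
  linarith

lemma abs_natCast_mul_pow_le (n : ℕ) {y : ℝ} (hy : 0 ≤ y) (hy1 : y ≤ 1) :
    |n * (y * (1 - y) ^ (n - 1))| ≤ n * y := by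
  have h1 : 0 ≤ 1 - y := by linarith
  rw [abs_of_nonneg (by positivity)]
  gcongr
  exact mul_le_of_le_one_right hy (pow_le_one₀ h1 (by linarith))

lemma pow_sub_pow_le_mul {a b : ℝ} (hb : 0 ≤ b) (hab : b ≤ a) (n : ℕ) :
    a ^ n - b ^ n ≤ n * (a - b) * a ^ (n - 1) := by
  induction n with
  | zero => simp
  | succ n ih =>
    have h1 : b ^ n ≤ a ^ n := by gcongr
    have h2 : (n : ℝ) * (a - b) * a ^ (n - 1) * a = n * (a - b) * a ^ n := by
      cases n with
      | zero => simp
      | succ n => rw [Nat.add_sub_cancel, pow_succ]; ring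
    have h3 := mul_le_mul_of_nonneg_right ih (hb.trans hab)
    have h4 := mul_le_mul_of_nonneg_left h1 (sub_nonneg.2 hab)
    rw [Nat.add_sub_cancel]
    push_cast
    have h5 : a ^ (n + 1) - b ^ (n + 1) = (a ^ n - b ^ n) * a + (a - b) * b ^ n := by ring
    linarith

/-- The Poisson approximation of the binomial probability of exactly one success. -/
lemma abs_binomial_sub_poisson_le {n : ℕ} (hn : 1 ≤ n) {y : ℝ} (hy : 0 ≤ y) (hy1 : y ≤ 1) :
    |n * (y * (1 - y) ^ (n - 1)) - n * y * Real.exp (-(n * y))|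
      ≤ 16 * Real.exp 1 / n * (n / 2 * y * Real.exp (-(n / 2 * y))) := by
  have hn0 : (0 : ℝ) < n := by exact_mod_cast hn
  set a := Real.exp (-y) with ha
  have hb : 0 ≤ 1 - y := by linarith
  have hab : 1 - y ≤ a := by have := Real.add_one_le_exp (-y); linarith
  have hab2 : a - (1 - y) ≤ y ^ 2 := by
    have h1 := Real.abs_exp_sub_one_sub_id_le (x := -y)
      (by rw [abs_neg, abs_of_nonneg hy]; exact hy1)
    have h2 := (abs_le.1 h1).2
    nlinarith
  have han : Real.exp (-(n * y)) = a ^ n := by rw [ha, ← Real.exp_nat_mul]; ring_nf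
  have ha0 : 0 < a := Real.exp_pos _
  have hpow : (1 - y) ^ (n - 1) ≤ a ^ (n - 1) := by gcongr
  have hsucc : ∀ c : ℝ, c ^ n = c ^ (n - 1) * c := fun c => by
    rw [← pow_succ, Nat.sub_add_cancel hn]
  -- The n-th powers differ by at most n y² a^(n-1), and (1-y)^(n-1) exceeds (1-y)^n by y
  -- (1-y)^(n-1).
  have key : |(1 - y) ^ (n - 1) - a ^ n| ≤ (y + n * y ^ 2) * a ^ (n - 1) := by
    have h1 : (1 - y) ^ n ≤ a ^ n := by gcongr
    have h2 := pow_sub_pow_le_mul hb hab n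
    have h3 : (n : ℝ) * (a - (1 - y)) * a ^ (n - 1) ≤ n * y ^ 2 * a ^ (n - 1) := by gcongr
    have h4 := hsucc (1 - y)
    have h5 : y * (1 - y) ^ (n - 1) ≤ y * a ^ (n - 1) := by gcongr
    have h6 : 0 ≤ y * (1 - y) ^ (n - 1) := by positivity
    have h7 : 0 ≤ n * y ^ 2 * a ^ (n - 1) := by positivity
    rw [abs_le]
    constructor <;> nlinarith
  have ha1 : a ^ (n - 1) ≤ Real.exp 1 * a ^ n := by
    rw [hsucc a, mul_left_comm]
    refine le_mul_of_one_le_right (by positivity) ?_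
    rw [ha, ← Real.exp_add]
    exact Real.one_le_exp (by linarith)
  -- Half of the exponential decay is spent on the quadratic factor, so the error is again the
  -- kernel x e^{-x}, now at n y / 2.
  have hquad : n * y + (n * y) ^ 2 ≤ 8 * Real.exp (n / 2 * y) := by
    have h1 := Real.quadratic_le_exp_of_nonneg (x := n / 2 * y) (by positivity)
    nlinarith [mul_nonneg hn0.le hy]
  have hexp : Real.exp (-(n / 2 * y)) = Real.exp (n / 2 * y) * a ^ n := by
    rw [← han, ← Real.exp_add]; ring_nf
  have e1 : n * (y * (1 - y) ^ (n - 1)) - n * y * Real.exp (-(n * y))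
      = n * y * ((1 - y) ^ (n - 1) - a ^ n) := by rw [han]; ring
  rw [e1, abs_mul, abs_of_nonneg (by positivity : (0 : ℝ) ≤ n * y)]
  calc n * y * |(1 - y) ^ (n - 1) - a ^ n|
      ≤ n * y * ((y + n * y ^ 2) * (Real.exp 1 * a ^ n)) := by gcongr; exact key.trans (by gcongr)
    _ = Real.exp 1 * y * a ^ n * (n * y + (n * y) ^ 2) := by ring
    _ ≤ Real.exp 1 * y * a ^ n * (8 * Real.exp (n / 2 * y)) := by gcongr
    _ = 16 * Real.exp 1 / n * (n / 2 * y * Real.exp (-(n / 2 * y))) := by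
        rw [hexp]; field_simp; ring

/-! ### Bounds for the Poisson mean, and depoissonization -/

section Mean

variable {p q : ℝ} (hp : 0 < p) (hq : 0 < q) (hpq : p + q = 1)
include hp hq hpq

lemma poissonMean_eq {x : ℝ} (hx : 0 ≤ x) :
    poissonMean p q x
      = x * Real.exp (-x) + p * poissonMean p q (p * x) + q * poissonMean p q (q * x) :=
  renewalSum_eq hp hq hpq (fun _ hy => abs_mul_exp_neg_le hy) hx

/-- This is the renewal equation of the potential, rewritten with p + q = 1 as a statement about
increments. Its right side tends to 1, which later fixes the limit of the mean. -/
lemma poissonPotential_eq {x : ℝ} (hx : 0 ≤ x) :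
    p * (poissonPotential p q x - poissonPotential p q (p * x))
      + q * (poissonPotential p q x - poissonPotential p q (q * x)) = 1 - Real.exp (-x) := by
  have h := renewalSum_eq hp hq hpq (fun _ hy => abs_one_sub_exp_neg_le hy) hx
  have h1 : poissonPotential p q x = (p + q) * poissonPotential p q x := by rw [hpq, one_mul]
  simp only [poissonPotential] at *
  linarith

lemma poissonMean_nonneg {x : ℝ} (hx : 0 ≤ x) : 0 ≤ poissonMean p q x :=
  tsum_nonneg fun m => average_iterate_nonneg hp hq hpq hx (fun y hy _ => by positivity) m

lemma poissonMean_le_mul {x : ℝ} (hx : 0 ≤ x) :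
    poissonMean p q x ≤ (1 - (p ^ 2 + q ^ 2))⁻¹ * x := by
  have h := abs_renewalSum_le hp hq hpq hx fun y hy _ => abs_mul_exp_neg_le hy
  rw [one_mul] at h
  exact (le_abs_self _).trans h

/-- Termwise this is convexity of the exponential: (1 - c) y e^{-y} ≤ e^{-cy} - e^{-y}. -/
lemma one_sub_mul_poissonMean_le {c x : ℝ} (hc : 0 ≤ c) (hx : 0 ≤ x) :
    (1 - c) * poissonMean p q x ≤ poissonPotential p q x - poissonPotential p q (c * x) := by
  have s0 := summable_average_iterate hp hq hpq hx fun y hy _ => abs_mul_exp_neg_le hy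
  have s1 := summable_average_iterate hp hq hpq hx fun y hy _ => abs_one_sub_exp_neg_le hy
  have s2 := summable_average_iterate hp hq hpq (mul_nonneg hc hx)
    fun y hy _ => abs_one_sub_exp_neg_le hy
  simp only [poissonMean, poissonPotential, renewalSum]
  rw [← tsum_mul_left, ← Summable.tsum_sub s1 s2]
  refine Summable.tsum_le_tsum (fun m => ?_) (s0.mul_left _) (s1.sub s2)
  rw [← average_iterate_const_mul, ← average_iterate_comp_mul, ← average_iterate_sub]
  refine average_iterate_mono hp hq hpq hx (fun y hy _ => ?_) m
  have h1 := Real.add_one_le_exp ((1 - c) * y)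
  have h2 : Real.exp (-(c * y)) = Real.exp (-y) * Real.exp ((1 - c) * y) := by
    rw [← Real.exp_add]; ring_nf
  have h3 := mul_le_mul_of_nonneg_left h1 (Real.exp_pos (-y)).le
  rw [h2]
  linarith

/-- The series of iterates alone bounds the mean only linearly. Boundedness comes from the
potential: with c = p, the quantity p q g(x) is at most the p-weighted increment, and the two
weighted increments are nonnegative with sum at most 1. -/
lemma poissonMean_le {x : ℝ} (hx : 0 ≤ x) : poissonMean p q x ≤ (p * q)⁻¹ := by
  have h1 := one_sub_mul_poissonMean_le hp hq hpq hp.le hx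
  have h2 := one_sub_mul_poissonMean_le hp hq hpq hq.le hx
  have h3 := poissonPotential_eq hp hq hpq hx
  have h4 := Real.exp_pos (-x)
  have h5 := poissonMean_nonneg hp hq hpq hx
  rw [show (1 - p) = q by linarith] at h1
  rw [show (1 - q) = p by linarith] at h2
  have h6 : 0 ≤ q * (poissonPotential p q x - poissonPotential p q (q * x)) :=
    mul_nonneg hq.le ((mul_nonneg hp.le h5).trans h2)
  rw [inv_eq_one_div, le_div_iff₀ (mul_pos hp hq)]
  nlinarith

/-- `poissonMean p q x / x` is antitone. -/
lemma poissonMean_mul_le {c x : ℝ} (hc : 1 ≤ c) (hx : 0 ≤ x) :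
    poissonMean p q (c * x) ≤ c * poissonMean p q x := by
  have hc0 : 0 ≤ c := by linarith
  have s0 := summable_average_iterate hp hq hpq hx fun y hy _ => abs_mul_exp_neg_le hy
  have s1 := summable_average_iterate hp hq hpq (mul_nonneg hc0 hx)
    fun y hy _ => abs_mul_exp_neg_le hy
  simp only [poissonMean, renewalSum]
  rw [← tsum_mul_left]
  refine Summable.tsum_le_tsum (fun m => ?_) s1 (s0.mul_left _)
  rw [← average_iterate_const_mul, ← average_iterate_comp_mul]
  refine average_iterate_mono hp hq hpq hx (fun y hy _ => ?_) m
  rw [mul_assoc]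
  gcongr
  nlinarith

lemma hasDerivAt_poissonPotential_exp (t : ℝ) :
    HasDerivAt (fun s => poissonPotential p q (Real.exp s)) (poissonMean p q (Real.exp t)) t := by
  have h := hasDerivAt_renewalSum hp hq hpq (h := fun y => 1 - Real.exp (-y))
    (k := fun y => y * Real.exp (-y)) (fun y hy => ?_)
    (fun _ hy => abs_one_sub_exp_neg_le hy) (fun _ hy => abs_mul_exp_neg_le hy) (Real.exp_pos t)
  · exact (h.comp t (Real.hasDerivAt_exp t)).congr_deriv (div_mul_cancel₀ _ (Real.exp_pos t).ne')
  · exact (((hasDerivAt_neg y).exp).const_sub 1).congr_deriv (by field_simp)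

/-- Depoissonization of the mean. -/
lemma tendsto_fixedMean_sub_poissonMean :
    Tendsto (fun n : ℕ => fixedMean p q n - poissonMean p q n) atTop (𝓝 0) := by
  have hbound : ∀ n : ℕ, 1 ≤ n →
      ‖fixedMean p q n - poissonMean p q n‖ ≤ 16 * Real.exp 1 * (p * q)⁻¹ / n := by
    intro n hn
    have hn0 : (0 : ℝ) < n := by exact_mod_cast hn
    have s0 := summable_average_iterate hp hq hpq hn0.le fun y hy _ => abs_mul_exp_neg_le hy
    have s1 := summable_average_iterate hp hq hpq zero_le_one
      fun y hy hy1 => abs_natCast_mul_pow_le n hy hy1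
    have s2 := summable_average_iterate hp hq hpq (x := n / 2) (by positivity)
      fun y hy _ => abs_mul_exp_neg_le hy
    have e : fixedMean p q n - poissonMean p q n = ∑' m, (average p q)^[m]
        (fun y => n * (y * (1 - y) ^ (n - 1)) - n * y * Real.exp (-(n * y))) 1 := by
      simp only [fixedMean, poissonMean, renewalSum]
      rw [← Summable.tsum_sub s1 s0]
      refine tsum_congr fun m => ?_
      rw [average_iterate_sub, average_iterate_comp_mul (h := fun y => y * Real.exp (-y)), mul_one]
    -- The pointwise error bound is itself a multiple of the Poisson kernel at n/2, so summing the
    -- iterates gives the Poisson mean there, which is bounded.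
    have h1 : ‖fixedMean p q n - poissonMean p q n‖
        ≤ 16 * Real.exp 1 / n * poissonMean p q (n / 2) := by
      rw [e]
      refine tsum_of_norm_bounded (s2.hasSum.mul_left _) fun m => ?_
      refine (abs_average_iterate_le_average hp hq hpq zero_le_one
        (fun y hy hy1 => abs_binomial_sub_poisson_le hn hy hy1) m).trans_eq ?_
      rw [average_iterate_const_mul, average_iterate_comp_mul (h := fun y => y * Real.exp (-y)),
        mul_one]
    refine h1.trans ?_
    exact (mul_le_mul_of_nonneg_left (poissonMean_le hp hq hpq (by positivity))
      (by positivity)).trans_eq (by ring)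
  refine squeeze_zero_norm' ?_ 
    (tendsto_const_div_atTop_nhds_zero_nat (16 * Real.exp 1 * (p * q)⁻¹))
  filter_upwards [eventually_ge_atTop 1] with n hn using hbound n hn

end Mean

/-! ### Asymptotics of solutions of the renewal equation -/

/-- A bounded function is close to an upper limit along some filter. -/
lemma exists_tendsto_limsup {u : ℝ → ℝ} {B : ℝ} (hB : ∀ t, |u t| ≤ B) :
    ∃ (η : ℝ) (l : Filter ℝ), l.NeBot ∧ l ≤ atTop ∧ Tendsto u l (𝓝 η) ∧
      ∀ ε > 0, ∀ᶠ t in atTop, u t ≤ η + ε := by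
  have hb1 : IsBoundedUnder (· ≤ ·) atTop u := isBoundedUnder_of ⟨B, fun t => (abs_le.1 (hB t)).2⟩
  have hb2 : IsBoundedUnder (· ≥ ·) atTop u := isBoundedUnder_of ⟨-B, fun t => (abs_le.1 (hB t)).1⟩
  have hlt : ∀ ε > 0, ∀ᶠ t in atTop, u t < limsup u atTop + ε := fun ε hε =>
    eventually_lt_of_limsup_lt (by linarith) hb1
  -- This filter plays the role of a sequence along which the upper limit is attained; it is proper
  -- because the upper limit is a cluster point.
  refine ⟨limsup u atTop, atTop ⊓ comap u (𝓝 (limsup u atTop)), ?_, inf_le_left,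
    tendsto_comap.mono_left inf_le_right, fun ε hε => (hlt ε hε).mono fun t => le_of_lt⟩
  have hc : MapClusterPt (limsup u atTop) atTop u := by
    rw [Metric.nhds_basis_ball.mapClusterPt_iff_frequently]
    intro ε hε
    refine ((frequently_lt_of_lt_limsup (b := limsup u atTop - ε)
      hb2.isCoboundedUnder_le (by linarith)).and_eventually (hlt ε hε)).mono fun t ht => ?_
    rw [Metric.mem_ball, Real.dist_eq, abs_lt]
    constructor <;> linarith [ht.1, ht.2]
  rw [← map_neBot_iff u, Filter.push_pull, inf_comm]
  exact hc

/-- It suffices that limsup ≤ c ≤ liminf. The lower limit is phrased as the upper limit of -u, so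
that the same propagation lemmas serve both halves. -/
lemma tendsto_of_forall_limsup {u : ℝ → ℝ} {B c : ℝ} (hB : ∀ t, |u t| ≤ B)
    (h1 : ∀ (η : ℝ) (l : Filter ℝ), l.NeBot → l ≤ atTop → Tendsto u l (𝓝 η) →
      (∀ ε > 0, ∀ᶠ t in atTop, u t ≤ η + ε) → η ≤ c)
    (h2 : ∀ (η : ℝ) (l : Filter ℝ), l.NeBot → l ≤ atTop → Tendsto (fun t => -u t) l (𝓝 (-η)) →
      (∀ ε > 0, ∀ᶠ t in atTop, -u t ≤ -η + ε) → c ≤ η) :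
    Tendsto u atTop (𝓝 c) := by
  obtain ⟨η, l, hl, hla, hu, hη⟩ := exists_tendsto_limsup hB
  obtain ⟨η', l', hl', hla', hu', hη'⟩ := exists_tendsto_limsup (u := fun t => -u t) (B := B)
    (by simpa using hB)
  have h3 := h1 η l hl hla hu hη
  have h4 := h2 (-η') l' hl' hla' (by simpa using hu') (by simpa using hη')
  rw [Metric.tendsto_nhds]
  intro ε hε
  filter_upwards [hη (ε / 2) (by positivity), hη' (ε / 2) (by positivity)] with t ht ht'
  rw [Real.dist_eq, abs_lt]
  constructor <;> linarith

/-! ### Maximum principle for approximate solutions -/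

section Propagation

variable {p q α β : ℝ} (hp : 0 < p) (hq : 0 < q) (hpq : p + q = 1)
include hp hq hpq

/-- Up to o(1), u(t) is a weighted mean of two values, neither of which exceeds η by much. If u(t)
is close to η, both must be. -/
lemma tendsto_sub_of_limsup {u : ℝ → ℝ} {η : ℝ} {l : Filter ℝ}
    (he : Tendsto (fun t => u t - p * u (t - α) - q * u (t - β)) atTop (𝓝 0))
    (hη : ∀ ε > 0, ∀ᶠ t in atTop, u t ≤ η + ε) (hl : l ≤ atTop) (hu : Tendsto u l (𝓝 η)) :
    Tendsto (fun t => u (t - α)) l (𝓝 η) := by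
  rw [Metric.tendsto_nhds]
  intro ε hε
  -- Three errors of this size enter the lower bound for p u(t - α): one each from u(t), from the
  -- equation and from u(t - β).
  have hε' : 0 < p * ε / 4 := by positivity
  have hs : ∀ c : ℝ, Tendsto (fun t => t - c) l atTop := fun c =>
    (tendsto_atTop_add_const_right atTop (-c) tendsto_id).mono_left hl
  filter_upwards [(Metric.tendsto_nhds.1 hu) _ hε', hl ((Metric.tendsto_nhds.1 he) _ hε'),
    (hs α).eventually (hη _ hε'), (hs β).eventually (hη _ hε')] with t h1 h2 h3 h4
  rw [Real.dist_eq, abs_lt] at *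
  have h5 := mul_le_mul_of_nonneg_left h4 hq.le
  have hp1 : p < 1 := by linarith
  have hq1 : q < 1 := by linarith
  have h6 : p * (η - ε) < p * u (t - α) := by
    have e : η = p * η + q * η := by rw [← add_mul, hpq, one_mul]
    nlinarith
  have h7 := lt_of_mul_lt_mul_left h6 hp.le
  constructor <;> nlinarith

/-- The one-step principle is iterated by replacing `l` with its translate, which still lies below
`atTop`. Steps by β use it with the two letters interchanged. -/
lemma tendsto_sub_semigroup_of_limsup {u : ℝ → ℝ} {η : ℝ} {l : Filter ℝ}
    (he : Tendsto (fun t => u t - p * u (t - α) - q * u (t - β)) atTop (𝓝 0))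
    (hη : ∀ ε > 0, ∀ᶠ t in atTop, u t ≤ η + ε) (hl : l ≤ atTop) (hu : Tendsto u l (𝓝 η))
    (j k : ℕ) : Tendsto (fun t => u (t - (j * α + k * β))) l (𝓝 η) := by
  have hs : ∀ (l : Filter ℝ) (c : ℝ), l ≤ atTop → map (fun t => t - c) l ≤ atTop := fun l c hl =>
    (tendsto_atTop_add_const_right atTop (-c) tendsto_id).mono_left hl
  induction j generalizing l with
  | zero =>
    induction k generalizing l with
    | zero => simpa using hu
    | succ k ih =>
      have he' : Tendsto (fun t => u t - q * u (t - β) - p * u (t - α)) atTop (𝓝 0) :=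
        he.congr fun t => by ring
      have h := ih (hs l β hl)
        (tendsto_sub_of_limsup hq hp (by linarith) he' hη hl hu)
      refine (tendsto_map'_iff.1 h).congr fun t => ?_
      simp only [Function.comp]
      congr 1
      push_cast
      ring
  | succ j ih =>
    have h := ih (hs l α hl) (tendsto_sub_of_limsup hp hq hpq he hη hl hu)
    refine (tendsto_map'_iff.1 h).congr fun t => ?_
    simp only [Function.comp]
    congr 1
    push_cast
    ring

end Propagation

/-- The additive semigroup generated by two incommensurable positive reals is asymptotically
dense. -/
lemma exists_semigroup_near {α β : ℝ} (hβ : 0 < β) (hαβ : Irrational (α / β))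
    {ε : ℝ} (hε : 0 < ε) :
    ∃ T : ℝ, ∀ y ≥ T, ∃ j k : ℕ, y - ε ≤ j * α + k * β ∧ j * α + k * β ≤ y := by
  obtain ⟨δ, hδ, hδ0, hδε⟩ := (dense_addSubgroupClosure_pair_iff.2 hαβ).exists_mem_open
    isOpen_Ioo (Set.nonempty_Ioo.2 hε)
  obtain ⟨m, n, hmn⟩ := AddSubgroup.mem_closure_pair.1 hδ
  simp only [zsmul_eq_mul] at hmn
  set M : ℕ := ⌈β / δ⌉₊
  -- The small group element δ = mα + nβ may have a negative coefficient. At most M copies of it are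
  -- needed to cover an interval of length β, and starting from Nα + Nβ keeps all coefficients
  -- nonnegative.
  set N : ℕ := M * (m.natAbs + n.natAbs)
  refine ⟨N * α + N * β, fun y hy => ?_⟩
  set k : ℕ := ⌊(y - (N * α + N * β)) / β⌋₊
  have hk1 : (k : ℝ) ≤ (y - (N * α + N * β)) / β := Nat.floor_le (div_nonneg (by linarith) hβ.le)
  have hk2 : (y - (N * α + N * β)) / β < k + 1 := Nat.lt_floor_add_one _
  rw [le_div_iff₀ hβ] at hk1
  -- Multiples of β bring y - (Nα + Nβ) down to a remainder z in [0, β), and multiples of δ < ε then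
  -- approximate z from below.
  rw [div_lt_iff₀ hβ] at hk2
  set z := y - (N * α + N * β) - k * β
  have hz : 0 ≤ z := by simp only [z]; linarith
  have hz1 : z < β := by simp only [z]; linarith
  set i : ℕ := ⌊z / δ⌋₊
  have hi1 : (i : ℝ) ≤ z / δ := Nat.floor_le (by positivity)
  have hi2 : z / δ < i + 1 := Nat.lt_floor_add_one _
  have hiM : i ≤ M := by
    have h1 : (i : ℝ) ≤ M := hi1.trans ((by gcongr : z / δ ≤ β / δ).trans (Nat.le_ceil _))
    exact_mod_cast h1
  rw [le_div_iff₀ hδ0] at hi1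
  rw [div_lt_iff₀ hδ0] at hi2
  have hnonneg : ∀ a : ℤ, a.natAbs ≤ m.natAbs + n.natAbs → 0 ≤ (N : ℤ) + i * a := by
    intro a ha
    have h1 : i * a.natAbs ≤ N := Nat.mul_le_mul hiM ha
    have h2 : (i : ℤ) * (a.natAbs : ℤ) ≤ N := by exact_mod_cast h1
    have h3 : -(a.natAbs : ℤ) ≤ a := by omega
    nlinarith [mul_le_mul_of_nonneg_left h3 (Int.natCast_nonneg i)]
  obtain ⟨j', hj'⟩ := Int.eq_ofNat_of_zero_le (hnonneg m (by omega))
  obtain ⟨k', hk'⟩ := Int.eq_ofNat_of_zero_le (hnonneg n (by omega))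
  have hj'' : (j' : ℝ) = N + i * m := by exact_mod_cast hj'.symm
  have hk'' : (k' : ℝ) = N + i * n := by exact_mod_cast hk'.symm
  refine ⟨j', k' + k, ?_⟩
  have e : (j' : ℝ) * α + ((k' + k : ℕ) : ℝ) * β = N * α + N * β + k * β + i * δ := by
    push_cast
    rw [hj'', hk'', ← hmn]
    ring
  rw [e]
  simp only [z] at hi1 hi2
  constructor <;> linarith

/-! ### Renewal theorem for incommensurable steps -/

section Nonlattice

variable {p q α β : ℝ} (hp : 0 < p) (hq : 0 < q) (hpq : p + q = 1) (hα : 0 < α) (hβ : 0 < β)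
include hp hq hpq hα hβ

/-- The renewal theorem for a step distribution on two incommensurable numbers `α`, `β`, for a
solution `g` of the renewal equation that varies slowly from one side and has a primitive `Φ` with
known weighted increments. -/
theorem tendsto_renewal_of_irrational {g Φ : ℝ → ℝ} {B : ℝ} (hαβ : Irrational (α / β))
    (hg0 : ∀ t, 0 ≤ g t) (hgB : ∀ t, g t ≤ B)
    (hgs : ∀ t s, 0 ≤ s → g (t + s) ≤ Real.exp s * g t)
    (he : Tendsto (fun t => g t - p * g (t - α) - q * g (t - β)) atTop (𝓝 0))
    (hΦ : ∀ t, HasDerivAt Φ (g t) t)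
    (hΦ1 : Tendsto (fun t => p * (Φ t - Φ (t - α)) + q * (Φ t - Φ (t - β))) atTop (𝓝 1)) :
    Tendsto g atTop (𝓝 (1 / (p * α + q * β))) := by
  have hH : 0 < p * α + q * β := by positivity
  have hΦc : Continuous Φ := continuous_iff_continuousAt.2 fun t => (hΦ t).continuousAt
  set γ := max α β with hγ
  have hs : ∀ c : ℝ, Tendsto (fun t : ℝ => t - c) atTop atTop := fun c =>
    tendsto_atTop_add_const_right atTop (-c) tendsto_id
  have hlower : ∀ (δ τ c : ℝ), 0 < δ → (∀ s, τ - δ ≤ s → s ≤ τ → c ≤ g s) →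
      c * δ ≤ Φ τ - Φ (τ - δ) := fun δ τ c hδ hc => by
    have h := (convex_Icc (τ - δ) τ).mul_sub_le_image_sub_of_le_deriv (f := Φ) (C := c)
      hΦc.continuousOn (fun s _ => (hΦ s).differentiableAt.differentiableWithinAt)
      (fun s hs => by
        rw [(hΦ s).deriv]
        rw [interior_Icc] at hs
        exact hc s hs.1.le hs.2.le) (τ - δ) ⟨le_rfl, by linarith⟩ τ ⟨by linarith, le_rfl⟩
      (by linarith)
    rwa [sub_sub_cancel] at h
  have hupper : ∀ (δ τ c : ℝ), 0 < δ → (∀ s, τ - δ ≤ s → s ≤ τ → g s ≤ c) →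
      Φ τ - Φ (τ - δ) ≤ c * δ := fun δ τ c hδ hc => by
    have h := (convex_Icc (τ - δ) τ).image_sub_le_mul_sub_of_deriv_le (f := Φ) (C := c)
      hΦc.continuousOn (fun s _ => (hΦ s).differentiableAt.differentiableWithinAt)
      (fun s hs => by
        rw [(hΦ s).deriv]
        rw [interior_Icc] at hs
        exact hc s hs.1.le hs.2.le) (τ - δ) ⟨le_rfl, by linarith⟩ τ ⟨by linarith, le_rfl⟩
      (by linarith)
    rwa [sub_sub_cancel] at h
  -- Only finitely many semigroup elements lie below T, so properties that hold eventually for each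
  -- hold eventually for all of them together.
  have hfin : ∀ (T : ℝ) (l : Filter ℝ) (Q : ℝ → Prop),
      (∀ j k : ℕ, ∀ᶠ t in l, Q (t - (j * α + k * β))) →
      ∀ᶠ t in l, ∀ j k : ℕ, j * α + k * β ≤ T → Q (t - (j * α + k * β)) := by
    intro T l Q hQ
    have h1 : ∀ᶠ t in l, ∀ jk ∈ Finset.range (⌈T / α⌉₊ + 1) ×ˢ Finset.range (⌈T / β⌉₊ + 1),
        Q (t - (jk.1 * α + jk.2 * β)) := (Finset.eventually_all _).2 fun jk _ => hQ jk.1 jk.2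
    have hle : ∀ (i : ℕ) (c : ℝ), 0 < c → i * c ≤ T → i < ⌈T / c⌉₊ + 1 := by
      intro i c hc hi
      rw [Nat.lt_succ_iff]
      have : (i : ℝ) ≤ ⌈T / c⌉₊ := ((le_div_iff₀ hc).2 hi).trans (Nat.le_ceil _)
      exact_mod_cast this
    filter_upwards [h1] with t ht j k hjk
    have hj : 0 ≤ (j : ℝ) * α := by positivity
    have hk : 0 ≤ (k : ℝ) * β := by positivity
    exact ht (j, k) (Finset.mem_product.2 ⟨Finset.mem_range.2 (hle j α hα (by linarith)),
      Finset.mem_range.2 (hle k β hβ (by linarith))⟩)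
  refine tendsto_of_forall_limsup (B := B)
    (fun t => abs_le.2 ⟨by linarith [hg0 t, hgB t], hgB t⟩) ?_ ?_
  · intro η l hl hla hu hη
    have hε : ∀ ε > 0, Real.exp (-ε) * (η - ε) * (p * α + q * β) ≤ 1 := by
      intro ε hε
      obtain ⟨T, hT⟩ := exists_semigroup_near hβ hαβ hε
      have h1 : ∀ᶠ t in l, ∀ j k : ℕ, j * α + k * β ≤ T + γ → η - ε < g (t - (j * α + k * β)) :=
        hfin _ l (fun s => η - ε < g s) fun j k =>
          (tendsto_sub_semigroup_of_limsup hp hq hpq he hη hla hu j k).eventually_const_lt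
            (by linarith)
      refine ge_of_tendsto ((hΦ1.comp (hs T)).mono_left hla) ?_
      filter_upwards [h1] with t ht
      have h2 : ∀ s, t - T - γ ≤ s → s ≤ t - T → Real.exp (-ε) * (η - ε) ≤ g s := by
        intro s hs1 hs2
        -- The point t - (jα + kβ) lies in [s, s + ε] and carries a value of g near the upper limit.
        -- As g grows at most by e^ε from s to it, g(s) is nearly as large.
        obtain ⟨j, k, hjk1, hjk2⟩ := hT (t - s) (by linarith)
        have h3 := ht j k (by linarith)
        have h4 := hgs s (t - s - (j * α + k * β)) (by linarith)
        rw [show s + (t - s - (j * α + k * β)) = t - (j * α + k * β) by ring] at h4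
        have h5 : Real.exp (t - s - (j * α + k * β)) * g s ≤ Real.exp ε * g s := by
          gcongr
          · exact hg0 s
          · linarith
        rw [Real.exp_neg, inv_mul_le_iff₀ (Real.exp_pos ε)]
        linarith
      have h6 := hlower α (t - T) _ hα fun s hs1 hs2 => h2 s (by linarith [le_max_left α β]) hs2
      have h7 := hlower β (t - T) _ hβ fun s hs1 hs2 => h2 s (by linarith [le_max_right α β]) hs2
      simp only [Function.comp]
      nlinarith [mul_le_mul_of_nonneg_left h6 hp.le, mul_le_mul_of_nonneg_left h7 hq.le]
    have hlim : Tendsto (fun ε : ℝ => Real.exp (-ε) * (η - ε) * (p * α + q * β)) (𝓝[>] 0)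
        (𝓝 (η * (p * α + q * β))) := by
      have hc : Continuous fun ε : ℝ => Real.exp (-ε) * (η - ε) * (p * α + q * β) := by fun_prop
      have := hc.tendsto 0
      simp only [neg_zero, Real.exp_zero, one_mul, sub_zero] at this
      exact this.mono_left nhdsWithin_le_nhds
    rw [le_div_iff₀ hH]
    exact le_of_tendsto hlim (eventually_mem_nhdsWithin.mono fun ε h => hε ε h)
  · intro η l hl hla hu hη
    have he' : Tendsto (fun t => -g t - p * (-g (t - α)) - q * (-g (t - β))) atTop (𝓝 0) := by
      simpa using he.neg.congr fun t => by ring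
    have hη0 : 0 ≤ η := by
      have h := hu.neg
      simp only [neg_neg] at h
      exact ge_of_tendsto' h hg0
    have hε : ∀ ε > 0, 1 ≤ Real.exp ε * (η + ε) * (p * α + q * β) := by
      intro ε hε
      obtain ⟨T, hT⟩ := exists_semigroup_near hβ hαβ hε
      have h1 : ∀ᶠ t in l, ∀ j k : ℕ, j * α + k * β ≤ T + γ + ε →
          g (t - (j * α + k * β)) < η + ε :=
        hfin _ l (fun s => g s < η + ε) fun j k =>
          ((tendsto_sub_semigroup_of_limsup hp hq hpq he' hη hla hu j k).eventually_const_lt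
            (by linarith : -η - ε < -η)).mono fun t ht => by linarith
      refine le_of_tendsto ((hΦ1.comp (hs T)).mono_left hla) ?_
      filter_upwards [h1] with t ht
      have h2 : ∀ s, t - T - γ ≤ s → s ≤ t - T → g s ≤ Real.exp ε * (η + ε) := by
        intro s hs1 hs2
        -- The one-sided growth bound now requires a semigroup translate to the left of s; the shift
        -- by ε puts it in [s - ε, s].
        obtain ⟨j, k, hjk1, hjk2⟩ := hT (t - s + ε) (by linarith)
        have h3 := ht j k (by linarith)
        have h4 := hgs (t - (j * α + k * β)) (s - (t - (j * α + k * β))) (by linarith)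
        rw [add_sub_cancel] at h4
        exact h4.trans (mul_le_mul (Real.exp_le_exp.2 (by linarith)) h3.le (hg0 _)
          (Real.exp_pos _).le)
      have h6 := hupper α (t - T) _ hα fun s hs1 hs2 => h2 s (by linarith [le_max_left α β]) hs2
      have h7 := hupper β (t - T) _ hβ fun s hs1 hs2 => h2 s (by linarith [le_max_right α β]) hs2
      simp only [Function.comp]
      nlinarith [mul_le_mul_of_nonneg_left h6 hp.le, mul_le_mul_of_nonneg_left h7 hq.le]
    have hlim : Tendsto (fun ε : ℝ => Real.exp ε * (η + ε) * (p * α + q * β)) (𝓝[>] 0)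
        (𝓝 (η * (p * α + q * β))) := by
      have hc : Continuous fun ε : ℝ => Real.exp ε * (η + ε) * (p * α + q * β) := by fun_prop
      have := hc.tendsto 0
      simp only [Real.exp_zero, one_mul, add_zero] at this
      exact this.mono_left nhdsWithin_le_nhds
    rw [div_le_iff₀ hH]
    exact ge_of_tendsto hlim (eventually_mem_nhdsWithin.mono fun ε h => hε ε h)

end Nonlattice

/-! ### Renewal theorem for commensurable steps -/

section Lattice

/-- The weighted window sum that is conserved by the lattice renewal equation. -/
noncomputable def windowSum (p q d : ℝ) (a b : ℕ) (u : ℝ → ℝ) (t : ℝ) : ℝ :=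
  p * ∑ i ∈ Finset.range a, u (t - i * d) + q * ∑ i ∈ Finset.range b, u (t - i * d)

lemma sum_range_sub_shift (u : ℝ → ℝ) (d t : ℝ) (a : ℕ) :
    ∑ i ∈ Finset.range a, u (t - i * d) - ∑ i ∈ Finset.range a, u (t - d - i * d)
      = u t - u (t - a * d) := by
  have h := Finset.sum_range_sub' (fun i : ℕ => u (t - i * d)) a
  simp only [Nat.cast_zero, zero_mul, sub_zero] at h
  rw [← h, ← Finset.sum_sub_distrib]
  refine Finset.sum_congr rfl fun i _ => ?_
  push_cast
  ring_nf

variable {p q d : ℝ} {a b : ℕ}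

/-- Telescoping leaves p (g(t) - g(t - ad)) + q (g(t) - g(t - bd)), which is f(t) by the renewal
equation: two long lags become one step d. -/
lemma windowSum_sub_shift (hpq : p + q = 1) {f g : ℝ → ℝ}
    (hg : ∀ t, g t = f t + p * g (t - a * d) + q * g (t - b * d)) (t : ℝ) :
    windowSum p q d a b g t - windowSum p q d a b g (t - d) = f t := by
  have h1 := sum_range_sub_shift g d t a
  have h2 := sum_range_sub_shift g d t b
  simp only [windowSum]
  have h3 := hg t
  have h4 : g t = (p + q) * g t := by rw [hpq, one_mul]
  linear_combination p * h1 + q * h2 + h3 - h4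

/-- The one-step relation is summed back to -∞, where g and hence the window sum vanish. -/
lemma hasSum_windowSum (hpq : p + q = 1) (hd : 0 < d) {f g : ℝ → ℝ}
    (hg : ∀ t, g t = f t + p * g (t - a * d) + q * g (t - b * d))
    (hg0 : Tendsto g atBot (𝓝 0)) {t : ℝ} (hf : Summable fun n : ℕ => f (t - n * d)) :
    HasSum (fun n : ℕ => f (t - n * d)) (windowSum p q d a b g t) := by
  have h1 : ∀ m : ℕ, ∑ n ∈ Finset.range m, f (t - n * d)
      = windowSum p q d a b g t - windowSum p q d a b g (t - m * d) := by
    intro m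
    induction m with
    | zero => simp
    | succ m ih =>
      rw [Finset.sum_range_succ, ih, ← windowSum_sub_shift hpq hg (t - m * d)]
      push_cast
      ring_nf
  have hs : ∀ i : ℕ, Tendsto (fun m : ℕ => g (t - m * d - i * d)) atTop (𝓝 0) := fun i => by
    refine hg0.comp (tendsto_atBot_add_const_right _ (-(i * d)) ?_)
    refine tendsto_atBot_add_const_left _ t (tendsto_neg_atTop_atBot.comp ?_)
    exact tendsto_natCast_atTop_atTop.atTop_mul_const hd
  have h2 : Tendsto (fun m : ℕ => windowSum p q d a b g (t - m * d)) atTop (𝓝 0) := by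
    have := ((tendsto_finsetSum (Finset.range a) fun i _ => hs i).const_mul p).add
      ((tendsto_finsetSum (Finset.range b) fun i _ => hs i).const_mul q)
    simpa [windowSum] using this
  have h3 := hf.hasSum.tendsto_sum_nat
  simp only [h1] at h3
  have h4 := tendsto_nhds_unique h3 (h2.const_sub _)
  rw [sub_zero] at h4
  rw [← h4]
  exact hf.hasSum

/-- By coprimality all integers from ab on have the form ja + kb, so along `l` a whole window of
translates of u tends to η. The window sum there tends to (pa + qb) η, and also to 0. -/
lemma limsup_eq_zero_of_windowSum (hp : 0 < p) (hq : 0 < q) (hpq : p + q = 1)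
    (ha : 0 < a) (hab : a.Coprime b) {u : ℝ → ℝ}
    (he : Tendsto (fun t => u t - p * u (t - a * d) - q * u (t - b * d)) atTop (𝓝 0))
    (hV : Tendsto (windowSum p q d a b u) atTop (𝓝 0))
    {η : ℝ} {l : Filter ℝ} [l.NeBot] (hl : l ≤ atTop) (hu : Tendsto u l (𝓝 η))
    (hη : ∀ ε > 0, ∀ᶠ t in atTop, u t ≤ η + ε) : η = 0 := by
  have h1 : ∀ i : ℕ, Tendsto (fun t => u (t - (a * b : ℕ) * d - i * d)) l (𝓝 η) := by
    intro i
    obtain ⟨j, k, hjk⟩ := Nat.exists_add_mul_eq_of_gcd_dvd_of_mul_pred_le a b (a * b + i)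
      (by simp [hab.gcd_eq_one])
      ((Nat.mul_le_mul (Nat.pred_le a) (Nat.pred_le b)).trans (Nat.le_add_right _ _))
    refine (tendsto_sub_semigroup_of_limsup hp hq hpq he hη hl hu j k).congr fun t => ?_
    have : ((a * b : ℕ) : ℝ) + i = j * a + k * b := by exact_mod_cast hjk.symm
    congr 1
    linear_combination d * this
  have h2 : Tendsto (fun t => windowSum p q d a b u (t - (a * b : ℕ) * d)) l
      (𝓝 ((p * a + q * b) * η)) := by
    have := ((tendsto_finsetSum (Finset.range a) fun i _ => h1 i).const_mul p).add
      ((tendsto_finsetSum (Finset.range b) fun i _ => h1 i).const_mul q)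
    have e : (p * a + q * b) * η = p * ∑ i ∈ Finset.range a, η + q * ∑ i ∈ Finset.range b, η := by
      simp only [Finset.sum_const, Finset.card_range, nsmul_eq_mul]
      ring
    rw [e]
    exact this
  have h3 : Tendsto (fun t => windowSum p q d a b u (t - (a * b : ℕ) * d)) l (𝓝 0) :=
    (hV.comp (tendsto_atTop_add_const_right atTop (-((a * b : ℕ) * d)) tendsto_id)).mono_left hl
  have h4 := tendsto_nhds_unique h2 h3
  have ha' : (0 : ℝ) < a := by exact_mod_cast ha
  rcases mul_eq_zero.1 h4 with h | h
  · have : 0 < p * a + q * b := by positivity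
    linarith
  · exact h

/-- The renewal theorem for a step distribution on two coprime multiples `a d`, `b d` of a positive
number `d`. -/
theorem tendsto_renewal_of_lattice (hp : 0 < p) (hq : 0 < q) (hpq : p + q = 1) (hd : 0 < d)
    (ha : 0 < a) (hab : a.Coprime b) {f g : ℝ → ℝ} {B C : ℝ}
    (hgB : ∀ t, |g t| ≤ B) (hg0 : Tendsto g atBot (𝓝 0))
    (hg : ∀ t, g t = f t + p * g (t - a * d) + q * g (t - b * d))
    (hf0 : ∀ t, 0 ≤ f t) (hf : ∀ t, f t ≤ C * Real.exp (-|t|)) :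
    Tendsto (fun t => g t - (p * a + q * b)⁻¹ * ∑' n : ℤ, f (t - n * d)) atTop (𝓝 0) := by
  have ha' : (0 : ℝ) < a := by exact_mod_cast ha
  have hab0 : 0 < p * a + q * b := by positivity
  have hC : 0 ≤ C := by simpa using (hf0 0).trans (hf 0)
  set r := Real.exp (-d) with hr
  have hr0 : 0 < r := Real.exp_pos _
  have hr1 : r < 1 := Real.exp_lt_one_iff.2 (by linarith)
  have hrn : ∀ n : ℕ, Real.exp (-(n * d)) = r ^ n := fun n => by
    rw [hr, ← Real.exp_nat_mul]; ring_nf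
  have hgeo := summable_geometric_of_lt_one hr0.le hr1
  have hsneg : ∀ t, Summable fun n : ℕ => f (t - n * d) := fun t => by
    refine Summable.of_nonneg_of_le (fun _ => hf0 _) (fun n => ?_)
      (hgeo.mul_left (C * Real.exp |t|))
    refine (hf _).trans ?_
    rw [mul_assoc, ← hrn, ← Real.exp_add]
    gcongr
    have h1 : |(n : ℝ) * d| ≤ |t| + |t - n * d| := by
      have := abs_sub t (t - n * d)
      rwa [sub_sub_cancel] at this
    rw [abs_of_nonneg (by positivity)] at h1
    linarith
  have hpos : ∀ t, 0 ≤ t → ∀ n : ℕ, f (t + (n + 1) * d) ≤ C * Real.exp (-t) * r ^ n := by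
    intro t ht n
    refine (hf _).trans ?_
    rw [mul_assoc, ← hrn, ← Real.exp_add]
    gcongr
    rw [abs_of_nonneg (by positivity)]
    linarith
  have hspos : ∀ t, Summable fun n : ℕ => f (t + (n + 1) * d) := fun t => by
    refine Summable.of_nonneg_of_le (fun _ => hf0 _) (fun n => ?_)
      (hgeo.mul_left (C * Real.exp |t|))
    refine (hf _).trans ?_
    rw [mul_assoc, ← hrn, ← Real.exp_add]
    gcongr
    have h1 : |((n : ℝ) + 1) * d| ≤ |t + (n + 1) * d| + |t| := by
      have := abs_sub (t + (n + 1) * d) t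
      rwa [add_sub_cancel_left] at this
    rw [abs_of_nonneg (by positivity)] at h1
    linarith
  set L : ℝ → ℝ := fun t => ∑' n : ℤ, f (t - n * d) with hL
  set R : ℝ → ℝ := fun t => ∑' n : ℕ, f (t + (n + 1) * d) with hR
  set W := windowSum p q d a b g with hW
  -- The terms n ≥ 0 of the periodization add up to the window sum of g; the terms n < 0 form a
  -- remainder that vanishes as t → ∞.
  have hLWR : ∀ t, L t = W t + R t := by
    intro t
    have h1 := hasSum_windowSum hpq hd hg hg0 (hsneg t)
    refine (HasSum.of_nat_of_neg_add_one (f := fun n : ℤ => f (t - n * d)) (by simpa using h1)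
      ?_).tsum_eq
    convert (hspos t).hasSum using 2 with n
    push_cast
    ring_nf
  have hLd : ∀ t, L (t - d) = L t := by
    intro t
    refine ((Equiv.addRight (1 : ℤ)).tsum_eq _).symm.trans ?_ |>.symm
    refine tsum_congr fun n => ?_
    simp only [Equiv.coe_addRight]
    push_cast
    ring_nf
  have hLm : ∀ (m : ℕ) (t), L (t - m * d) = L t := by
    intro m
    induction m with
    | zero => simp
    | succ m ih =>
      intro t
      rw [← ih t, ← hLd (t - m * d)]
      push_cast
      ring_nf
  have hR0 : ∀ t, 0 ≤ R t := fun t => tsum_nonneg fun n => hf0 _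
  have hRle : ∀ t, 0 ≤ t → R t ≤ C * Real.exp (-t) * (1 - r)⁻¹ := fun t ht => by
    have h1 := ((hasSum_geometric_of_lt_one hr0.le hr1).mul_left (C * Real.exp (-t)))
    exact h1.tsum_eq ▸ (hspos t).tsum_le_tsum (hpos t ht) h1.summable
  have hRt : Tendsto R atTop (𝓝 0) := by
    refine squeeze_zero' (.of_forall hR0) ((eventually_ge_atTop 0).mono hRle) ?_
    have := (Real.tendsto_exp_neg_atTop_nhds_zero.const_mul C).mul_const (1 - r)⁻¹
    simpa using this
  have hft : Tendsto f atTop (𝓝 0) := by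
    refine squeeze_zero' (g := fun t => C * Real.exp (-t)) (.of_forall hf0) ?_ ?_
    · filter_upwards [eventually_ge_atTop 0] with t ht
      have := hf t
      rwa [abs_of_nonneg ht] at this
    · simpa using Real.tendsto_exp_neg_atTop_nhds_zero.const_mul C
  have hB0 : 0 ≤ B := (abs_nonneg _).trans (hgB 0)
  have hWB : ∀ t, |W t| ≤ (p * a + q * b) * B := by
    have h1 : ∀ (t : ℝ) (m : ℕ), |∑ i ∈ Finset.range m, g (t - i * d)| ≤ m * B := fun t m => by
      refine (Finset.abs_sum_le_sum_abs _ _).trans ?_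
      refine (Finset.sum_le_sum fun i _ => hgB _).trans ?_
      simp
    intro t
    refine (abs_add_le _ _).trans ?_
    rw [abs_mul, abs_mul, abs_of_pos hp, abs_of_pos hq, add_mul, mul_assoc, mul_assoc]
    gcongr <;> exact h1 t _
  have hLB : ∀ t, |L t| ≤ (p * a + q * b) * B + C * (1 - r)⁻¹ := by
    intro t
    obtain ⟨m, hm⟩ := exists_nat_ge (-t / d)
    rw [div_le_iff₀ hd] at hm
    have h1 : L t = L (t + m * d) := by rw [← hLm m (t + m * d), add_sub_cancel_right]
    have h2 : 0 ≤ t + m * d := by linarith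
    rw [h1, hLWR]
    refine (abs_add_le _ _).trans (add_le_add (hWB _) ?_)
    rw [abs_of_nonneg (hR0 _)]
    refine (hRle _ h2).trans ?_
    have h3 : 0 ≤ (1 - r)⁻¹ := by
      have : 0 < 1 - r := by linarith
      positivity
    gcongr
    exact mul_le_of_le_one_right hC (Real.exp_le_one_iff.2 (by linarith))
  set c := (p * a + q * b)⁻¹ with hc
  have hc0 : 0 ≤ c := by positivity
  have hV : ∀ t, windowSum p q d a b (fun s => g s - c * L s) t = -R t := by
    intro t
    have h1 : windowSum p q d a b (fun s => g s - c * L s) t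
        = W t - c * windowSum p q d a b L t := by
      simp only [hW, windowSum, Finset.sum_sub_distrib, ← Finset.mul_sum]
      ring
    have h2 : windowSum p q d a b L t = (p * a + q * b) * L t := by
      simp only [windowSum, hLm, Finset.sum_const, Finset.card_range, nsmul_eq_mul]
      ring
    rw [h1, h2, hc, inv_mul_cancel_left₀ hab0.ne', hLWR]
    ring
  have hV0 : Tendsto (windowSum p q d a b (fun s => g s - c * L s)) atTop (𝓝 0) := by
    rw [funext hV]
    simpa using hRt.neg
  -- L has period d, so it cancels from the equation and only f, which tends to 0, is left.
  have he : Tendsto (fun t => (g t - c * L t) - p * (g (t - a * d) - c * L (t - a * d))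
      - q * (g (t - b * d) - c * L (t - b * d))) atTop (𝓝 0) := by
    refine hft.congr fun t => ?_
    rw [hLm, hLm]
    linear_combination -c * L t * hpq - hg t
  refine tendsto_of_forall_limsup (B := B + c * ((p * a + q * b) * B + C * (1 - r)⁻¹))
    (fun t => ?_) ?_ ?_
  · refine (abs_sub _ _).trans (add_le_add (hgB t) ?_)
    rw [abs_mul, abs_of_nonneg hc0]
    exact mul_le_mul_of_nonneg_left (hLB t) hc0
  · intro η l hl hla hu hη
    exact (limsup_eq_zero_of_windowSum hp hq hpq ha hab he hV0 hla hu hη).le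
  · intro η l hl hla hu hη
    have h1 := limsup_eq_zero_of_windowSum (d := d) (b := b)
      (u := fun t => -(g t - c * L t)) hp hq hpq ha hab ?_ ?_ hla hu hη
    · linarith
    · simpa using he.neg.congr fun t => by ring
    · have : windowSum p q d a b (fun t => -(g t - c * L t)) = fun t =>
          -windowSum p q d a b (fun t => g t - c * L t) t := by
        funext t
        simp only [windowSum, Finset.sum_neg_distrib]
        ring
      rw [this]
      simpa using hV0.neg

end Lattice

/-! ### The oscillating term and Poisson summation -/

/-- The kernel `x e^{-x}` in the logarithmic variable `t = log x`. -/
noncomputable def meanKernel (t : ℝ) : ℝ := Real.exp t * Real.exp (-Real.exp t)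

lemma continuous_meanKernel : Continuous meanKernel := by unfold meanKernel; fun_prop

lemma meanKernel_nonneg (t : ℝ) : 0 ≤ meanKernel t := by unfold meanKernel; positivity

lemma meanKernel_le (t : ℝ) : meanKernel t ≤ 2 * Real.exp (-|t|) := by
  have h0 := Real.exp_pos t
  rcases le_total t 0 with ht | ht
  · rw [abs_of_nonpos ht, neg_neg, meanKernel]
    have : Real.exp (-Real.exp t) ≤ 1 := Real.exp_le_one_iff.2 (by linarith)
    nlinarith
  · rw [abs_of_nonneg ht, meanKernel, Real.exp_neg, Real.exp_neg, ← div_eq_mul_inv,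
      ← div_eq_mul_inv, div_le_div_iff₀ (Real.exp_pos _) h0]
    have := Real.quadratic_le_exp_of_nonneg h0.le
    nlinarith

lemma tendsto_meanKernel : Tendsto meanKernel atTop (𝓝 0) := by
  refine squeeze_zero' (g := fun t => 2 * Real.exp (-t)) (.of_forall meanKernel_nonneg) ?_ ?_
  · filter_upwards [eventually_ge_atTop 0] with t ht
    have := meanKernel_le t
    rwa [abs_of_nonneg ht] at this
  · simpa using Real.tendsto_exp_neg_atTop_nhds_zero.const_mul 2

lemma norm_Gamma_le {s : ℂ} (hs : 0 < s.re) : ‖Complex.Gamma s‖ ≤ Real.Gamma s.re := by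
  rw [Complex.Gamma_eq_integral hs, Real.Gamma_eq_integral hs, Complex.GammaIntegral]
  refine (norm_integral_le_integral_norm _).trans_eq ?_
  refine setIntegral_congr_fun measurableSet_Ioi fun x hx => ?_
  simp only [norm_mul, Complex.norm_real, Complex.norm_cpow_eq_rpow_re_of_pos hx]
  simp

/-- Two steps of the functional equation give Γ(3 + iy) = (2 + iy)(1 + iy) Γ(1 + iy). The left side
has modulus at most Γ(3) = 2, and each linear factor has modulus at least |y|. -/
lemma norm_Gamma_one_add_mul_I_le {y : ℝ} (hy : y ≠ 0) :
    ‖Complex.Gamma (1 + y * Complex.I)‖ ≤ 2 / y ^ 2 := by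
  have him : ∀ n : ℝ, |y| ≤ ‖(n : ℂ) + y * Complex.I‖ := fun n => by
    simpa using Complex.abs_im_le_norm ((n : ℂ) + y * Complex.I)
  have hne : ∀ n : ℝ, (n : ℂ) + y * Complex.I ≠ 0 := fun n h => by
    have := him n
    rw [h, norm_zero] at this
    exact hy (abs_eq_zero.1 (le_antisymm this (abs_nonneg y)))
  have e1 := Complex.Gamma_add_one _ (hne 1)
  have e2 := Complex.Gamma_add_one _ (hne 2)
  rw [show ((1 : ℝ) : ℂ) + y * Complex.I + 1 = (2 : ℝ) + y * Complex.I by push_cast; ring] at e1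
  have h3 := norm_Gamma_le (s := ((2 : ℝ) : ℂ) + y * Complex.I + 1) (by simp; norm_num)
  have h4 : (((2 : ℝ) : ℂ) + y * Complex.I + 1).re = ((2 : ℕ) : ℝ) + 1 := by simp
  rw [h4, Real.Gamma_nat_eq_factorial, e2, e1, norm_mul, norm_mul] at h3
  have h5 : 0 < |y| := abs_pos.2 hy
  have h6 := him 1
  have h7 := him 2
  rw [le_div_iff₀ (by positivity), ← sq_abs]
  simp only [Complex.ofReal_one] at h3 h6
  have h8 : |y| * (|y| * ‖Complex.Gamma (1 + y * Complex.I)‖) ≤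
      ‖((2 : ℝ) : ℂ) + y * Complex.I‖ *
        (‖1 + y * Complex.I‖ * ‖Complex.Gamma (1 + y * Complex.I)‖) := by gcongr
  have h9 : ((Nat.factorial 2 : ℕ) : ℝ) = 2 := by norm_num [Nat.factorial]
  rw [h9] at h3
  nlinarith

open FourierTransform in
-- Γ is the Mellin transform of e^{-x}, and the substitution x = e^{-u} makes it a Fourier
-- transform; this sign is why the kernel appears reflected.
lemma fourier_meanKernel_neg (y : ℝ) :
    𝓕 (fun u : ℝ => (meanKernel (-u) : ℂ)) y = Complex.Gamma (1 + 2 * Real.pi * y * Complex.I) := by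
  have h := mellin_eq_fourier (fun x : ℝ => ((Real.exp (-x) : ℝ) : ℂ))
    (s := 1 + 2 * Real.pi * y * Complex.I)
  have hre : (1 + 2 * Real.pi * y * Complex.I).re = 1 := by simp
  have him : (1 + 2 * Real.pi * y * Complex.I).im = 2 * Real.pi * y := by simp
  rw [hre, him, mul_div_cancel_left₀ _ (by positivity)] at h
  rw [Complex.Gamma_eq_integral (by rw [hre]; exact one_pos), Complex.GammaIntegral_eq_mellin, h]
  refine congrArg (fun F : ℝ → ℂ => 𝓕 F y) (funext fun u => ?_)
  simp [meanKernel]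

open FourierTransform in
lemma fourier_meanKernel_neg_mul {d : ℝ} (hd : 0 < d) (y : ℝ) :
    𝓕 (fun u : ℝ => (meanKernel (-(d * u)) : ℂ)) y
      = (d : ℂ)⁻¹ * Complex.Gamma (1 + 2 * Real.pi * (y / d) * Complex.I) := by
  have h := fourier_meanKernel_neg (y / d)
  rw [Real.fourier_real_eq_integral_exp_smul] at h ⊢
  push_cast at h
  rw [← h]
  have h1 := Measure.integral_comp_mul_left
    (fun u : ℝ => Complex.exp ((-2 * Real.pi * u * (y / d) : ℝ) * Complex.I) •
      (meanKernel (-u) : ℂ)) d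
  rw [abs_of_pos (inv_pos.2 hd)] at h1
  have h2 : ∀ u : ℝ, -2 * Real.pi * (d * u) * (y / d) = -2 * Real.pi * u * y := fun u => by
    field_simp
  simp only [h2] at h1
  rw [h1, Complex.real_smul]
  push_cast
  rfl

/-- Poisson summation for the reflected kernel scaled by d, at the point -t/d, followed by k ↦ -k.
The quadratic decay of Γ on the line Re = 1 makes the dual series summable. -/
lemma hasSum_Gamma_mul_exp {d : ℝ} (hd : 0 < d) (t : ℝ) :
    HasSum (fun k : ℤ => Complex.Gamma (1 - 2 * Real.pi * Complex.I * k / d) *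
      Complex.exp (2 * Real.pi * Complex.I * k * t / d))
      ((d * ∑' n : ℤ, meanKernel (t - n * d) : ℝ) : ℂ) := by
  have hd' : (d : ℂ) ≠ 0 := by exact_mod_cast hd.ne'
  have hbound : ∀ k : ℤ, k ≠ 0 →
      ‖Complex.Gamma (1 + 2 * Real.pi * ((k : ℝ) / d) * Complex.I)‖
        ≤ 2 * d ^ 2 / (2 * Real.pi) ^ 2 * ((k : ℝ) ^ 2)⁻¹ := fun k hk => by
    have hk' : (k : ℝ) ≠ 0 := by exact_mod_cast hk
    have h := norm_Gamma_one_add_mul_I_le (y := 2 * Real.pi * (k / d)) (by positivity)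
    push_cast at h
    refine h.trans_eq ?_
    field_simp
  have hsq : Summable fun k : ℤ => 2 * d ^ 2 / (2 * Real.pi) ^ 2 * ((k : ℝ) ^ 2)⁻¹ :=
    ((Real.summable_one_div_int_pow (p := 2)).2 one_lt_two).mul_left _ |>.congr
      fun k => by rw [one_div]
  have hs : Summable fun k : ℤ => ‖Complex.Gamma (1 + 2 * Real.pi * ((k : ℝ) / d) * Complex.I)‖ :=
    Summable.of_norm_bounded_eventually hsq (by
      filter_upwards [(Set.finite_singleton (0 : ℤ)).compl_mem_cofinite] with k hk
      rw [norm_norm]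
      exact hbound k hk)
  have hdecay : (fun u : ℝ => (meanKernel (-(d * u)) : ℂ)) =O[cocompact ℝ]
      fun x => |x| ^ (-2 : ℝ) := by
    refine Asymptotics.IsBigO.of_bound (4 / d ^ 2) ?_
    filter_upwards [(isCompact_singleton (x := (0 : ℝ))).compl_mem_cocompact] with u hu
    have hu0 : 0 < |u| := abs_pos.2 hu
    rw [Complex.norm_real, Real.norm_of_nonneg (meanKernel_nonneg _),
      Real.norm_of_nonneg (by positivity), Real.rpow_neg hu0.le, Real.rpow_two]
    refine (meanKernel_le _).trans ?_
    rw [abs_neg, abs_mul, abs_of_pos hd, Real.exp_neg, ← div_eq_mul_inv, ← div_eq_mul_inv, div_div,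
      div_le_div_iff₀ (Real.exp_pos _) (by positivity)]
    have := Real.quadratic_le_exp_of_nonneg (x := d * |u|) (by positivity)
    have : 0 ≤ d * |u| := by positivity
    nlinarith
  have hpoisson := Real.tsum_eq_tsum_fourier_of_rpow_decay_of_summable
    (f := fun u : ℝ => (meanKernel (-(d * u)) : ℂ))
    (Complex.continuous_ofReal.comp (continuous_meanKernel.comp (by fun_prop))) one_lt_two hdecay
    (by
      simp only [fourier_meanKernel_neg_mul hd]
      refine Summable.mul_left _ (Summable.of_norm ?_)
      exact_mod_cast hs) (-t / d)
  have hsum : Summable fun k : ℤ => Complex.Gamma (1 - 2 * Real.pi * Complex.I * k / d) *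
      Complex.exp (2 * Real.pi * Complex.I * k * t / d) := by
    refine Summable.of_norm (((Equiv.neg ℤ).summable_iff.2 hs).congr fun k => ?_)
    have e1 : 2 * Real.pi * Complex.I * k * t / d = (2 * Real.pi * k * t / d : ℝ) * Complex.I := by
      push_cast; ring
    rw [norm_mul, e1, Complex.norm_exp_ofReal_mul_I, mul_one]
    simp only [Function.comp, Equiv.neg_apply]
    congr 2
    push_cast
    ring
  convert hsum.hasSum using 1
  simp only [fourier_meanKernel_neg_mul hd, fourier_coe_apply] at hpoisson
  have h1 : ∀ n : ℤ, -(d * (-t / d + n)) = t - n * d := fun n => by field_simp; ring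
  simp only [h1] at hpoisson
  push_cast
  rw [hpoisson, ← tsum_mul_left, ← (Equiv.neg ℤ).tsum_eq]
  refine tsum_congr fun k => ?_
  rw [mul_assoc, mul_inv_cancel_left₀ hd']
  simp only [Equiv.neg_apply]
  congr 2 <;> · push_cast; ring_nf

section Oscillation

variable {p q : ℝ} (hp : 0 < p) (hq : 0 < q) (hpq : p + q = 1)
include hp hq hpq

lemma poissonMean_exp_eq (t : ℝ) :
    poissonMean p q (Real.exp t) = meanKernel t
      + p * poissonMean p q (Real.exp (t - -Real.log p))
      + q * poissonMean p q (Real.exp (t - -Real.log q)) := by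
  have h := poissonMean_eq hp hq hpq (Real.exp_pos t).le
  rw [sub_neg_eq_add, sub_neg_eq_add, add_comm t, add_comm t, Real.exp_add, Real.exp_add,
    Real.exp_log hp, Real.exp_log hq]
  exact h

lemma tendsto_poissonMean_of_irrational (hirr : Irrational (Real.log p / Real.log q)) :
    Tendsto (fun t => poissonMean p q (Real.exp t)) atTop
      (𝓝 (1 / (p * -Real.log p + q * -Real.log q))) := by
  have hp1 : p < 1 := by linarith
  have hq1 : q < 1 := by linarith
  refine tendsto_renewal_of_irrational (α := -Real.log p) (β := -Real.log q) hp hq hpq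
    (neg_pos.2 (Real.log_neg hp hp1)) (neg_pos.2 (Real.log_neg hq hq1))
    (Φ := fun t => poissonPotential p q (Real.exp t)) (B := (p * q)⁻¹) (by rwa [neg_div_neg_eq])
    (fun t => poissonMean_nonneg hp hq hpq (Real.exp_pos t).le)
    (fun t => poissonMean_le hp hq hpq (Real.exp_pos t).le) (fun t s hs => ?_) ?_
    (hasDerivAt_poissonPotential_exp hp hq hpq) ?_
  · rw [add_comm, Real.exp_add]
    exact poissonMean_mul_le hp hq hpq (Real.one_le_exp hs) (Real.exp_pos t).le
  · refine tendsto_meanKernel.congr fun t => ?_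
    rw [poissonMean_exp_eq hp hq hpq t]
    ring
  · have h1 : Tendsto (fun t => 1 - Real.exp (-Real.exp t)) atTop (𝓝 1) := by
      simpa using (Real.tendsto_exp_neg_atTop_nhds_zero.comp Real.tendsto_exp_atTop).const_sub 1
    refine h1.congr fun t => ?_
    rw [← poissonPotential_eq hp hq hpq (Real.exp_pos t).le]
    simp only [sub_neg_eq_add, add_comm t, Real.exp_add, Real.exp_log hp, Real.exp_log hq]

lemma tendsto_poissonMean_sub_of_lattice {d : ℝ} (hd : 0 < d) {a b : ℕ} (ha : 0 < a)
    (hab : a.Coprime b) (hap : Real.log p = -(a * d)) (hbq : Real.log q = -(b * d)) :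
    Tendsto (fun t => poissonMean p q (Real.exp t)
      - (p * a + q * b)⁻¹ * ∑' n : ℤ, meanKernel (t - n * d)) atTop (𝓝 0) := by
  refine tendsto_renewal_of_lattice (B := (p * q)⁻¹) hp hq hpq hd ha hab (fun t => ?_) ?_
    (fun t => ?_) meanKernel_nonneg meanKernel_le
  · rw [abs_of_nonneg (poissonMean_nonneg hp hq hpq (Real.exp_pos t).le)]
    exact poissonMean_le hp hq hpq (Real.exp_pos t).le
  · refine squeeze_zero (fun t => poissonMean_nonneg hp hq hpq (Real.exp_pos t).le)
      (fun t => poissonMean_le_mul hp hq hpq (Real.exp_pos t).le) ?_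
    simpa using Real.tendsto_exp_atBot.const_mul (1 - (p ^ 2 + q ^ 2))⁻¹
  · have h := poissonMean_exp_eq hp hq hpq t
    rwa [hap, hbq, neg_neg, neg_neg] at h

omit hpq in
-- With log p / log q = a/b in lowest terms, d = -log q / b. By Bézout, d is an integer combination
-- of the two logarithms, hence an integer multiple of every common divisor.
lemma exists_span_of_not_irrational (hp1 : p < 1) (hq1 : q < 1)
    (hrat : ¬ Irrational (Real.log p / Real.log q)) :
    ∃ (d : ℝ) (a b : ℕ), 0 < d ∧ 0 < a ∧ a.Coprime b ∧ Real.log p = -(a * d) ∧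
      Real.log q = -(b * d) ∧ IsGreatest (commonDivisors (Real.log p) (Real.log q)) d := by
  have hlp := Real.log_neg hp hp1
  have hlq := Real.log_neg hq hq1
  rw [Irrational, not_not] at hrat
  obtain ⟨r, hr⟩ := hrat
  have hr0 : 0 < r := by
    have : (0 : ℝ) < r := by rw [hr]; exact div_pos_of_neg_of_neg hlp hlq
    exact_mod_cast this
  have hden : (0 : ℝ) < r.den := by exact_mod_cast r.den_pos
  obtain ⟨a, ha⟩ := Int.eq_ofNat_of_zero_le (Rat.num_nonneg.2 hr0.le)
  have ha0 : 0 < a := by have := Rat.num_pos.2 hr0; omega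
  have hcop : a.Coprime r.den := by
    have := r.reduced
    rwa [ha] at this
  set d := -Real.log q / r.den with hd
  have hd0 : 0 < d := div_pos (neg_pos.2 hlq) hden
  have hlq' : Real.log q = -(r.den * d) := by rw [hd]; field_simp
  have hlp' : Real.log p = -(a * d) := by
    have h1 : (r : ℝ) = a / r.den := by
      rw [Rat.cast_def, ha]
      simp
    rw [h1, div_eq_div_iff hden.ne' hlq.ne, hlq'] at hr
    have : (r.den : ℝ) * (Real.log p) = r.den * (-(a * d)) := by linarith
    exact mul_left_cancel₀ hden.ne' this
  refine ⟨d, a, r.den, hd0, ha0, hcop, hlp', hlq', ⟨hd0, ⟨-a, ?_⟩, ⟨-r.den, ?_⟩⟩, ?_⟩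
  · rw [hlp']; push_cast; ring
  · rw [hlq']; push_cast; ring
  · rintro d' ⟨hd', ⟨m, hm⟩, ⟨n, hn⟩⟩
    obtain ⟨u, v, huv⟩ := Nat.isCoprime_iff_coprime.2 hcop
    have h1 : (u : ℝ) * a + v * r.den = 1 := by exact_mod_cast huv
    have h2 : d = (-(u * m + v * n) : ℤ) * d' := by
      push_cast
      linear_combination -d * h1 + u * hlp' + v * hlq' - u * hm - v * hn
    have h3 : 0 < ((-(u * m + v * n) : ℤ) : ℝ) := by
      by_contra! h
      nlinarith
    have h4 : (1 : ℝ) ≤ (-(u * m + v * n) : ℤ) := by exact_mod_cast h3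
    nlinarith

/-- The asymptotics of the mean in the Poisson model. -/
theorem exists_isOscillation_tendsto_poissonMean {H : ℝ}
    (hH : H = -p * Real.log p - q * Real.log q) :
    ∃ ψ : ℝ → ℝ, IsOscillation p q H ψ ∧
      Tendsto (fun x => poissonMean p q x - (1 / H + ψ (Real.log x) / (2 * p * q)))
        atTop (𝓝 0) := by
  have hlog : ∀ {F : ℝ → ℝ}, Tendsto (fun t => poissonMean p q (Real.exp t) - F t) atTop (𝓝 0) →
      Tendsto (fun x => poissonMean p q x - F (Real.log x)) atTop (𝓝 0) := fun {F} h => by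
    refine (h.comp Real.tendsto_log_atTop).congr' ?_
    filter_upwards [eventually_gt_atTop 0] with x hx
    simp only [Function.comp, Real.exp_log hx]
  by_cases hirr : Irrational (Real.log p / Real.log q)
  · refine ⟨fun _ => 0, ⟨fun _ _ => rfl, fun h => absurd hirr h⟩, hlog (F := fun _ => _) ?_⟩
    have h := (tendsto_poissonMean_of_irrational hp hq hpq hirr).sub_const (1 / H + 0 / (2 * p * q))
    rwa [hH, show p * -Real.log p + q * -Real.log q = -p * Real.log p - q * Real.log q by ring,
      ← hH, show 1 / H - (1 / H + 0 / (2 * p * q)) = 0 by simp] at h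
  · obtain ⟨d, a, b, hd, ha, hab, hlp, hlq, hgreat⟩ :=
      exists_span_of_not_irrational hp hq (by linarith) (by linarith) hirr
    have ha' : (0 : ℝ) < a := by exact_mod_cast ha
    have hab0 : 0 < p * a + q * b := by positivity
    have hHd : H = d * (p * a + q * b) := by rw [hH, hlp, hlq]; ring
    have hH0 : H ≠ 0 := by rw [hHd]; positivity
    -- The subtracted 1 is the term k = 0, namely Γ(1). Since H = d (pa + qb), it accounts for 1/H
    -- in the mean.
    refine ⟨fun t => 2 * p * q / H * (d * ∑' n : ℤ, meanKernel (t - n * d) - 1),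
      ⟨fun h => absurd h hirr, fun _ => ⟨d, hgreat, fun t => ?_⟩⟩, hlog (F := fun t => 1 / H +
        2 * p * q / H * (d * ∑' n : ℤ, meanKernel (t - n * d) - 1) / (2 * p * q)) ?_⟩
    · have h1 := (hasSum_Gamma_mul_exp hd t).sub (hasSum_ite_eq (0 : ℤ) (1 : ℂ))
      have h2 := ((hasSum_subtype_iff_indicator (s := {k : ℤ | k ≠ 0})
        (f := fun k : ℤ => Complex.Gamma (1 - 2 * Real.pi * Complex.I * k / d) *
          Complex.exp (2 * Real.pi * Complex.I * k * t / d))).2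
        (h1.congr_fun ?_)).mul_left (2 * p * q / H : ℂ)
      · have e : ((2 * p * q / H * (d * ∑' n : ℤ, meanKernel (t - n * d) - 1) : ℝ) : ℂ)
            = 2 * p * q / H * ((d * ∑' n : ℤ, meanKernel (t - n * d) : ℝ) - 1) := by
          rw [Complex.ofReal_mul, Complex.ofReal_sub]
          push_cast
          rfl
        simp only [e]
        exact h2
      · intro k
        by_cases hk : k = 0
        · simp [hk, Set.indicator]
        · simp [hk, Set.indicator]
    · refine (tendsto_poissonMean_sub_of_lattice hp hq hpq hd ha hab hlp hlq).congr fun t => ?_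
      congr 1
      rw [hHd]
      field_simp
      ring_nf

end Oscillation

/-! ### New internal nodes as levels with a unique match -/

/-- The infinite string `s` passes through the node `a`. -/
def PassesThrough : List Bool → BitString → Prop
  | [], _ => True
  | b :: a, s => s 0 = b ∧ PassesThrough a fun i => s (i + 1)

lemma passesThrough_iff (a : List Bool) (s : BitString) :
    PassesThrough a s ↔ a = List.ofFn fun i : Fin a.length => s i := by
  induction a generalizing s with
  | nil => simp [PassesThrough]
  | cons b a ih => simp [PassesThrough, ih, List.ofFn_succ, eq_comm]

lemma passesThrough_ofFn_iff (s t : BitString) (k : ℕ) :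
    PassesThrough (List.ofFn fun i : Fin k => s i) t ↔ ∀ l < k, t l = s l := by
  induction k generalizing s t with
  | zero => simp [PassesThrough]
  | succ k ih =>
    rw [List.ofFn_succ, PassesThrough]
    simp only [Fin.val_succ, Fin.val_zero]
    rw [ih (fun i => s (i + 1)) (fun i => t (i + 1)), Nat.forall_lt_succ_left]

lemma branch_passesThrough (b : Bool) (a : List Bool) (S : Set BitString) :
    {s ∈ branch b S | PassesThrough a s} = branch b {s ∈ S | PassesThrough (b :: a) s} := by
  ext s
  constructor
  · rintro ⟨⟨t, ht, hb, rfl⟩, ha⟩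
    exact ⟨t, ⟨ht, hb, ha⟩, hb, rfl⟩
  · rintro ⟨t, ⟨ht, hb, ha⟩, -, rfl⟩
    exact ⟨⟨t, ht, hb, rfl⟩, ha⟩

lemma branch_nontrivial_iff {b : Bool} {S : Set BitString} (hS : ∀ s ∈ S, s 0 = b) :
    (branch b S).Nontrivial ↔ S.Nontrivial := by
  have h : branch b S = (fun s i => s (i + 1)) '' S := by
    ext s
    constructor
    · rintro ⟨t, ht, -, rfl⟩
      exact ⟨t, ht, rfl⟩
    · rintro ⟨t, ht, rfl⟩
      exact ⟨t, ht, hS t ht, rfl⟩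
  rw [h]
  refine Set.InjOn.image_nontrivial_iff fun s hs t ht hst => ?_
  funext i
  cases i with
  | zero => rw [hS s hs, hS t ht]
  | succ i => exact congrFun hst i

/-- A node is internal iff at least two strings pass through it. -/
lemma trie_eq_internal_iff (S : Set BitString) (a : List Bool) :
    trie S a = NodeKind.internal ↔ {s ∈ S | PassesThrough a s}.Nontrivial := by
  induction a generalizing S with
  | nil =>
    simp only [trie, PassesThrough, and_true, Set.ofPred_mem_eq]
    split_ifs with h1 h2
    · simp [h1]
    · simp [h2]
    · simp [h2]
  | cons b a ih =>
    rw [trie]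
    split_ifs with h
    · rw [ih, branch_passesThrough, branch_nontrivial_iff fun s hs => hs.2.1]
    · simp only [false_iff]
      exact fun h' => h (h'.mono fun s hs => hs.1)

/-- Exactly one of the strings numbered `1, …, n` shares its first `k` letters with the string
numbered `0`. -/
def UniqueMatch (x : ℕ → BitString) (n k : ℕ) : Prop :=
  ∃! i, (1 ≤ i ∧ i ≤ n) ∧ ∀ l < k, x i l = x 0 l

/-- A node changes only if the new string passes through it, and it becomes internal iff exactly one
old string did. Injectivity is needed because the trie sees a set of strings, whereas `UniqueMatch`
counts indices. -/
lemma insertionCount_eq_ncard {x : ℕ → BitString} (hx : Function.Injective x) (n : ℕ) :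
    insertionCount x n = {k | UniqueMatch x n k}.ncard := by
  have hinj : Function.Injective fun k => List.ofFn fun i : Fin k => x 0 i := fun k k' h => by
    simpa using congrArg List.length h
  rw [insertionCount, newInternalNodes, ← Set.ncard_image_of_injective _ hinj]
  congr 1
  ext a
  simp only [Set.mem_ofPred_eq, ne_eq, trie_eq_internal_iff, Set.mem_image]
  have h0 : ∀ i, 1 ≤ i → x i ≠ x 0 := fun i hi h => by
    have := hx h
    omega
  constructor
  · rintro ⟨h1, h2⟩
    rw [Set.not_nontrivial_iff] at h2
    have ha : PassesThrough a (x 0) := by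
      by_contra ha
      refine Set.not_nontrivial_iff.2 h2 (h1.mono ?_)
      rintro s ⟨rfl | hs, hs'⟩
      · exact absurd hs' ha
      · exact ⟨hs, hs'⟩
    have hofFn := (passesThrough_iff a (x 0)).1 ha
    obtain ⟨s, ⟨hs, hs'⟩, hne⟩ := h1.exists_ne (x 0)
    obtain ⟨i, hi1, hin, rfl⟩ := hs.resolve_left hne
    refine ⟨a.length, ⟨i, ⟨⟨hi1, hin⟩, ?_⟩, fun i' hi' => ?_⟩, hofFn.symm⟩
    · rwa [hofFn, passesThrough_ofFn_iff] at hs'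
    · have h3 := (passesThrough_ofFn_iff (x 0) (x i') a.length).2 hi'.2
      rw [← hofFn] at h3
      exact hx (h2 ⟨⟨i', hi'.1.1, hi'.1.2, rfl⟩, h3⟩ ⟨⟨i, hi1, hin, rfl⟩, hs'⟩)
  · rintro ⟨k, ⟨i, ⟨⟨hi1, hin⟩, hi⟩, huniq⟩, rfl⟩
    constructor
    · refine ⟨x i, ⟨Or.inr ⟨i, hi1, hin, rfl⟩, (passesThrough_ofFn_iff _ _ _).2 hi⟩, x 0,
        ⟨Or.inl rfl, (passesThrough_ofFn_iff _ _ _).2 fun _ _ => rfl⟩, h0 i hi1⟩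
    · rw [Set.not_nontrivial_iff]
      rintro s ⟨⟨j, hj1, hjn, rfl⟩, hj⟩ t ⟨⟨j', hj1', hjn', rfl⟩, hj'⟩
      rw [passesThrough_ofFn_iff] at hj hj'
      rw [huniq j ⟨⟨hj1, hjn⟩, hj⟩, huniq j' ⟨⟨hj1', hjn'⟩, hj'⟩]

lemma finite_uniqueMatch {x : ℕ → BitString} (hx : Function.Injective x) (n : ℕ) :
    {k | UniqueMatch x n k}.Finite := by
  refine ((Set.finite_Icc 1 n).biUnion (t := fun i => {k | ∀ l < k, x i l = x 0 l}) ?_).subset ?_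
  · intro i hi
    have hne : x i ≠ x 0 := fun h => by
      have := hx h
      have := hi.1
      omega
    obtain ⟨l, hl⟩ := Function.ne_iff.1 hne
    exact (Set.finite_Iic l).subset fun k hk => not_lt.1 fun hlk => hl (hk l hlk)
  · rintro k ⟨i, ⟨hi, hik⟩, -⟩
    exact Set.mem_biUnion (Set.mem_Icc.2 hi) hik

/-- A string matching k + j letters also matches k, so uniqueness at level k makes the two matching
strings equal. -/
lemma uniqueMatch_and_iff (x : ℕ → BitString) (n k j : ℕ) :
    UniqueMatch x n k ∧ UniqueMatch x n (k + j) ↔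
      ∃ i, (1 ≤ i ∧ i ≤ n) ∧ (∀ l < k + j, x i l = x 0 l) ∧
        ∀ i', (1 ≤ i' ∧ i' ≤ n) → i' ≠ i → ¬ ∀ l < k, x i' l = x 0 l := by
  constructor
  · rintro ⟨⟨i, ⟨hi, hik⟩, h1⟩, i', ⟨hi', hik'⟩, -⟩
    have e := h1 i' ⟨hi', fun l hl => hik' l (by omega)⟩
    subst e
    exact ⟨i', hi', hik', fun i'' hi'' hne h => hne (h1 i'' ⟨hi'', h⟩)⟩
  · rintro ⟨i, hi, hik, h⟩
    refine ⟨⟨i, ⟨hi, fun l hl => hik l (by omega)⟩, fun i' hi' => ?_⟩,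
      i, ⟨hi, hik⟩, fun i' hi' => ?_⟩ <;> by_contra hne
    · exact h i' hi'.1 hne hi'.2
    · exact h i' hi'.1 hne fun l hl => hi'.2 l (by omega)

lemma ordConnected_uniqueMatch (x : ℕ → BitString) (n : ℕ) :
    {k | UniqueMatch x n k}.OrdConnected := by
  refine ⟨fun k hk k' hk' m hm => ?_⟩
  obtain ⟨j, rfl⟩ := Nat.exists_eq_add_of_le (hm.1.trans hm.2)
  obtain ⟨i, hi, hik, h⟩ := (uniqueMatch_and_iff x n k j).1 ⟨hk, hk'⟩
  refine ⟨i, ⟨hi, fun l hl => hik l (hl.trans_le hm.2)⟩, fun i' hi' => ?_⟩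
  by_contra hne
  exact h i' hi'.1 hne fun l hl => hi'.2 l (hl.trans_le hm.1)

/-- For an interval, counting pairs at distance j yields the truncated difference (|A| - j)⁺, which
turns two-level probabilities into moments of N. -/
lemma ncard_inter_shift {A : Set ℕ} (hA : A.Finite) (hA' : A.OrdConnected) (j : ℕ) :
    {k | k ∈ A ∧ k + j ∈ A}.ncard = A.ncard - j := by
  rcases A.eq_empty_or_nonempty with rfl | hne
  · simp
  have hA1 : A = Finset.Icc (sInf A) (sSup A) := by
    rw [Finset.coe_Icc]
    exact Set.Subset.antisymm (fun c hc => ⟨Nat.sInf_le hc, le_csSup hA.bddAbove hc⟩)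
      (hA'.out (Nat.sInf_mem hne) (Nat.sSup_mem hne hA.bddAbove))
  generalize sInf A = a at hA1
  generalize sSup A = b at hA1
  have hA2 : {k | k ∈ A ∧ k + j ∈ A} = Finset.Ico a (b + 1 - j) := by
    ext k
    rw [hA1]
    simp only [Set.mem_ofPred_eq, Finset.mem_coe, Finset.mem_Icc, Finset.mem_Ico]
    omega
  rw [hA2, hA1, Set.ncard_coe_finset, Set.ncard_coe_finset, Nat.card_Icc, Nat.card_Ico]
  omega

/-! ### The law of a random number of consecutive levels -/

section Levels

variable {Ω : Type*} [MeasurableSpace Ω] {P : Measure Ω} [IsProbabilityMeasure P]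
  {N : Ω → ℕ} {E : ℕ → Set Ω} {r a : ℝ}

lemma tsum_indicator_one_eq_ncard {A : Set ℕ} (hA : A.Finite) :
    ∑' k, A.indicator (1 : ℕ → ENNReal) k = (A.ncard : ENNReal) := by
  have h := ENNReal.tsum_set_one A
  rw [← hA.cast_ncard_eq] at h
  rw [← tsum_subtype A (1 : ℕ → ENNReal)]
  simpa using h

variable (hEm : ∀ k, MeasurableSet (E k))
  (hN : ∀ᵐ ω ∂P, N ω = {k | ω ∈ E k}.ncard ∧ {k | ω ∈ E k}.Finite ∧ {k | ω ∈ E k}.OrdConnected)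
  (hr : 0 ≤ r) (ha : 0 ≤ a) (hE : ∀ j, HasSum (fun k => P.real (E k ∩ E (k + j))) (r ^ j * a))
include hEm hN

omit [IsProbabilityMeasure P] hEm in
lemma ae_tsum_indicator_eq (j : ℕ) :
    (fun ω => ∑' k, (E k ∩ E (k + j)).indicator (1 : Ω → ENNReal) ω)
      =ᵐ[P] fun ω => ((N ω - j : ℕ) : ENNReal) := by
  filter_upwards [hN] with ω hω
  obtain ⟨h1, h2, h3⟩ := hω
  rw [h1, ← ncard_inter_shift h2 h3 j,
    ← tsum_indicator_one_eq_ncard (h2.subset fun k hk => hk.1)]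
  exact tsum_congr fun k => rfl

omit [IsProbabilityMeasure P] in
-- N itself is not assumed measurable; it agrees almost everywhere with the sum of the indicators of
-- the level events.
lemma aemeasurable_level_count : AEMeasurable N P := by
  have h1 : AEMeasurable (fun ω => ((N ω - 0 : ℕ) : ENNReal)) P :=
    AEMeasurable.congr (Measurable.tsum fun k =>
      measurable_one.indicator ((hEm k).inter (hEm (k + 0)))).aemeasurable
      (ae_tsum_indicator_eq hN 0)
  have h2 := (Nat.measurable_floor (R := ℝ)).comp_aemeasurable h1.ennreal_toReal
  refine h2.congr (.of_forall fun ω => ?_)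
  simp

include hr ha hE

lemma integrable_and_integral_level_count_sub (j : ℕ) :
    Integrable (fun ω => ((N ω - j : ℕ) : ℝ)) P ∧
      ∫ ω, ((N ω - j : ℕ) : ℝ) ∂P = r ^ j * a := by
  have hm : ∀ k, Measurable ((E k ∩ E (k + j)).indicator (1 : Ω → ENNReal)) := fun k =>
    measurable_one.indicator ((hEm k).inter (hEm (k + j)))
  have hX : AEMeasurable (fun ω => ((N ω - j : ℕ) : ENNReal)) P :=
    (Measurable.tsum hm).aemeasurable.congr (ae_tsum_indicator_eq hN j)
  have hl : ∫⁻ ω, ((N ω - j : ℕ) : ENNReal) ∂P = ENNReal.ofReal (r ^ j * a) := by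
    rw [← lintegral_congr_ae (ae_tsum_indicator_eq hN j),
      lintegral_tsum fun k => (hm k).aemeasurable, ← (hE j).tsum_eq,
      ENNReal.ofReal_tsum_of_nonneg (fun _ => measureReal_nonneg) (hE j).summable]
    refine tsum_congr fun k => ?_
    rw [lintegral_indicator_one ((hEm k).inter (hEm (k + j))), ofReal_measureReal]
  have h1 := integrable_toReal_of_lintegral_ne_top hX (by rw [hl]; exact ENNReal.ofReal_ne_top)
  have h2 := integral_toReal hX (.of_forall fun ω => ENNReal.natCast_lt_top _)
  rw [hl, ENNReal.toReal_ofReal (by positivity)] at h2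
  simp only [ENNReal.toReal_natCast] at h1 h2
  exact ⟨h1, h2⟩

lemma measureReal_level_count_eq_zero : P.real {ω | N ω = 0} = 1 - (1 - r) * a := by
  have h0 := integrable_and_integral_level_count_sub hEm hN hr ha hE 0
  have h1 := integrable_and_integral_level_count_sub hEm hN hr ha hE 1
  have h01 : Integrable (fun ω => ((N ω - 0 : ℕ) : ℝ) - ((N ω - 1 : ℕ) : ℝ)) P := h0.1.sub h1.1
  have hs : NullMeasurableSet {ω | N ω = 0} P :=
    (aemeasurable_level_count hEm hN).nullMeasurableSet_preimage (measurableSet_singleton 0)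
  -- N - (N - 1)⁺ is the indicator of N ≥ 1.
  have e : ∫ ω, {ω | N ω = 0}.indicator (fun _ => (1 : ℝ)) ω ∂P
      = ∫ ω, (1 - (((N ω - 0 : ℕ) : ℝ) - ((N ω - 1 : ℕ) : ℝ))) ∂P := by
    congr 1
    funext ω
    rcases hn : N ω with _ | n <;> simp [Set.indicator, hn]
  rw [integral_indicator₀ hs, setIntegral_const, integral_sub (integrable_const _) h01,
    integral_sub h0.1 h1.1, h0.2, h1.2] at e
  simp only [smul_eq_mul, mul_one, integral_const, probReal_univ] at e
  rw [e]
  ring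

lemma measureReal_level_count_eq_succ (j : ℕ) :
    P.real {ω | N ω = j + 1} = (1 - r) ^ 2 * r ^ j * a := by
  have h0 := integrable_and_integral_level_count_sub hEm hN hr ha hE j
  have h1 := integrable_and_integral_level_count_sub hEm hN hr ha hE (j + 1)
  have h2 := integrable_and_integral_level_count_sub hEm hN hr ha hE (j + 2)
  have h01 : Integrable (fun ω => ((N ω - j : ℕ) : ℝ) - ((N ω - (j + 1) : ℕ) : ℝ)) P :=
    h0.1.sub h1.1
  have h12 : Integrable (fun ω => ((N ω - (j + 1) : ℕ) : ℝ) - ((N ω - (j + 2) : ℕ) : ℝ)) P :=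
    h1.1.sub h2.1
  have hs : NullMeasurableSet {ω | N ω = j + 1} P :=
    (aemeasurable_level_count hEm hN).nullMeasurableSet_preimage (measurableSet_singleton (j + 1))
  -- The second difference of j ↦ (N - j)⁺ is the indicator of N = j + 1, which yields the geometric
  -- law.
  have e : ∫ ω, {ω | N ω = j + 1}.indicator (fun _ => (1 : ℝ)) ω ∂P
      = ∫ ω, ((((N ω - j : ℕ) : ℝ) - ((N ω - (j + 1) : ℕ) : ℝ))
        - (((N ω - (j + 1) : ℕ) : ℝ) - ((N ω - (j + 2) : ℕ) : ℝ))) ∂P := by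
    congr 1
    funext ω
    rcases lt_trichotomy (N ω) (j + 1) with h | h | h
    · have e0 : N ω - j = 0 := by omega
      have e1 : N ω - (j + 1) = 0 := by omega
      have e2 : N ω - (j + 2) = 0 := by omega
      simp [Set.indicator, h.ne, e0, e1, e2]
    · simp [Set.indicator, h]
    · obtain ⟨m, hm⟩ := Nat.exists_eq_add_of_lt h
      have e0 : N ω - j = m + 2 := by omega
      have e1 : N ω - (j + 1) = m + 1 := by omega
      have e2 : N ω - (j + 2) = m := by omega
      rw [Set.indicator_of_notMem (by simpa using h.ne'), e0, e1, e2]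
      push_cast
      ring
  rw [integral_indicator₀ hs, setIntegral_const, integral_sub h01 h12,
    integral_sub h0.1 h1.1, integral_sub h1.1 h2.1, h0.2, h1.2, h2.2] at e
  simp only [smul_eq_mul, mul_one] at e
  rw [e]
  ring

end Levels

/-- The asymptotics of the law follow from those of the mean. -/
lemma insertionAsymptotics_of_mean {Ω ι : Type*} [MeasurableSpace Ω] {P : Measure Ω}
    [IsProbabilityMeasure P] {p q H : ℝ} (hp : 0 < p) (hq : 0 < q) (hpq : p + q = 1) {ψ : ℝ → ℝ}
    {l : Filter ι} {s : ι → ℝ} {N : ι → Ω → ℕ} {E : ι → ℕ → Set Ω} {a : ι → ℝ}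
    (hEm : ∀ i k, MeasurableSet (E i k))
    (hN : ∀ i, ∀ᵐ ω ∂P, N i ω = {k | ω ∈ E i k}.ncard ∧ {k | ω ∈ E i k}.Finite ∧
      {k | ω ∈ E i k}.OrdConnected)
    (ha : ∀ i, 0 ≤ a i)
    (hE : ∀ i j, HasSum (fun k => P.real (E i k ∩ E i (k + j))) ((p ^ 2 + q ^ 2) ^ j * a i))
    (hlim : Tendsto (fun i => a i - (1 / H + ψ (Real.log (s i)) / (2 * p * q))) l (𝓝 0)) :
    InsertionAsymptotics P p q H ψ l s N := by
  have hr : 0 ≤ p ^ 2 + q ^ 2 := by positivity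
  have e1 : 1 - (p ^ 2 + q ^ 2) = 2 * p * q := by
    linear_combination -(p + q + 1) * hpq
  have e2 : p ^ 2 + q ^ 2 = 1 - 2 * p * q := by linarith
  refine ⟨?_, fun j hj => ?_, fun i => ?_, ?_⟩
  · have h := hlim.const_mul (-(2 * p * q))
    rw [mul_zero] at h
    refine h.congr fun i => ?_
    rw [measureReal_level_count_eq_zero (hEm i) (hN i) hr (ha i) (hE i), e1]
    field_simp
    ring
  · obtain ⟨j, rfl⟩ := Nat.exists_eq_add_of_le' hj
    have h := hlim.const_mul ((2 * p * q) ^ 2 * (1 - 2 * p * q) ^ j)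
    rw [mul_zero] at h
    refine h.congr fun i => ?_
    rw [measureReal_level_count_eq_succ (hEm i) (hN i) hr (ha i) (hE i), e1, e2,
      Nat.add_sub_cancel]
    field_simp
  · simpa using (integrable_and_integral_level_count_sub (hEm i) (hN i) hr (ha i) (hE i) 0).1
  · refine hlim.congr fun i => ?_
    have h := (integrable_and_integral_level_count_sub (hEm i) (hN i) hr (ha i) (hE i) 0).2
    simp only [Nat.sub_zero, pow_zero, one_mul] at h
    rw [h]

/-! ### Probabilities of words -/

/-- The probability of a letter. -/
def letterProb (p q : ℝ) (b : Bool) : ℝ := cond b p q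

/-- The probability of a finite word. -/
def wordProb (p q : ℝ) {m : ℕ} (w : Fin m → Bool) : ℝ := ∏ l, letterProb p q (w l)

/-- The infinite strings that start with the word `w`. -/
def wordCylinder {m : ℕ} (w : Fin m → Bool) : Set BitString := {s | ∀ l : Fin m, s l = w l}

lemma measurableSet_wordCylinder {m : ℕ} (w : Fin m → Bool) : MeasurableSet (wordCylinder w) := by
  have e : wordCylinder w = ⋂ l : Fin m, (fun s : BitString => s l) ⁻¹' {w l} := by
    ext s
    simp [wordCylinder]
  rw [e]
  exact MeasurableSet.iInter fun l => measurable_pi_apply _ (measurableSet_singleton _)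

lemma wordProb_append {p q : ℝ} {k j : ℕ} (u : Fin k → Bool) (v : Fin j → Bool) :
    wordProb p q (Fin.append u v) = wordProb p q u * wordProb p q v := by
  simp [wordProb, Fin.prod_univ_add]

lemma sum_wordProb_sq (p q : ℝ) (j : ℕ) :
    ∑ w : Fin j → Bool, wordProb p q w ^ 2 = (p ^ 2 + q ^ 2) ^ j := by
  have h := Finset.prod_univ_sum (fun _ : Fin j => (Finset.univ : Finset Bool))
    (fun _ b => letterProb p q b ^ 2)
  rw [Fintype.piFinset_univ] at h
  simp only [wordProb, ← Finset.prod_pow]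
  rw [← h]
  simp [letterProb]

/-- Splitting off the first letter of a word is one application of `average`; this links string
probabilities to the renewal series. -/
lemma sum_wordProb_mul (p q : ℝ) (h : ℝ → ℝ) (m : ℕ) (x : ℝ) :
    ∑ w : Fin m → Bool, wordProb p q w * h (x * wordProb p q w) = (average p q)^[m] h x := by
  induction m generalizing x with
  | zero => simp [wordProb]
  | succ m ih =>
    rw [average_iterate_succ, ← ih, ← ih, ← (Fin.consEquiv fun _ => Bool).sum_comp,
      Fintype.sum_prod_type]
    simp only [Fintype.sum_bool, Fin.consEquiv_apply, wordProb, Fin.prod_univ_succ, Fin.cons_zero,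
      Fin.cons_succ, letterProb, cond_true, cond_false, Finset.mul_sum]
    congr 1 <;> refine Finset.sum_congr rfl fun w _ => ?_ <;> ring_nf

section Words

variable {Ω : Type*} [MeasurableSpace Ω] {P : Measure Ω} [IsProbabilityMeasure P] {p q : ℝ}
  {ξ : ℕ → ℕ → Ω → Bool} (hm : ∀ i k, Measurable (ξ i k))
  (hlaw : ∀ i k b, P.real {ω | ξ i k ω = b} = letterProb p q b)
  (hind : iIndepFun (fun ik : ℕ × ℕ => ξ ik.1 ik.2) P)
include hm hind

/-- The law of all letters is a product over pairs of indices; currying makes it a product of the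
laws of the rows. -/
lemma iIndepFun_rows : iIndepFun (fun i ω k => ξ i k ω) P := by
  have hrow : ∀ i, Measurable fun ω k => ξ i k ω := fun i => measurable_pi_iff.2 fun k => hm i k
  have hprob : ∀ i k, IsProbabilityMeasure (P.map (ξ i k)) := fun i k =>
    Measure.isProbabilityMeasure_map (hm i k).aemeasurable
  have h1 := hind.map_fun_eq_infinitePi_map (fun ik : ℕ × ℕ => hm ik.1 ik.2)
  have h2 : ∀ i, P.map (fun ω k => ξ i k ω) = Measure.infinitePi fun k => P.map (ξ i k) := fun i =>
    (hind.precomp (g := fun k => (i, k)) fun k k' h => (Prod.mk.inj h).2).map_fun_eq_infinitePi_map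
      (hm i)
  rw [iIndepFun_iff_map_fun_eq_infinitePi_map hrow]
  simp only [h2]
  rw [← Measure.infinitePi_map_curry (fun i k => P.map (ξ i k)), ← h1,
    Measure.map_map (by fun_prop) (measurable_pi_iff.2 fun ik : ℕ × ℕ => hm ik.1 ik.2)]
  rfl

include hlaw

omit [IsProbabilityMeasure P] hm in
lemma measureReal_wordCylinder (i : ℕ) {m : ℕ} (w : Fin m → Bool) :
    P.real {ω | (fun k => ξ i k ω) ∈ wordCylinder w} = wordProb p q w := by
  have h := (hind.precomp (g := fun l : Fin m => (i, (l : ℕ)))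
    fun l l' h => Fin.ext (Prod.mk.inj h).2).measure_inter_preimage_eq_mul Finset.univ
    (sets := fun l => {w l}) fun l _ => measurableSet_singleton _
  have e : {ω | (fun k => ξ i k ω) ∈ wordCylinder w}
      = ⋂ l ∈ (Finset.univ : Finset (Fin m)), ξ i l ⁻¹' {w l} := by
    ext ω
    simp [wordCylinder]
  rw [e, measureReal_def, h, ENNReal.toReal_prod]
  exact Finset.prod_congr rfl fun l _ => hlaw i l (w l)

/-- Two different random strings are almost surely different. -/
lemma ae_injective_rows (hp : 0 < p) (hq : 0 < q) (hpq : p + q = 1) :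
    ∀ᵐ ω ∂P, Function.Injective fun i k => ξ i k ω := by
  have hne : ∀ i i', i ≠ i' → ∀ᵐ ω ∂P, (fun k => ξ i k ω) ≠ fun k => ξ i' k ω := by
    intro i i' hii
    -- Equal strings share their first m letters, and two independent strings do so with probability
    -- (p² + q²)^m.
    have hle : ∀ m : ℕ, P.real {ω | (fun k => ξ i k ω) = fun k => ξ i' k ω}
        ≤ (p ^ 2 + q ^ 2) ^ m := by
      intro m
      have hpair := (iIndepFun_rows hm hind).indepFun hii
      rw [← sum_wordProb_sq]
      refine (measureReal_mono (s₂ := ⋃ w ∈ (Finset.univ : Finset (Fin m → Bool)),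
        {ω | (fun k => ξ i k ω) ∈ wordCylinder w} ∩ {ω | (fun k => ξ i' k ω) ∈ wordCylinder w})
        ?_ (measure_ne_top _ _)).trans ((measureReal_biUnion_finset_le _ _).trans_eq ?_)
      · intro ω hω
        have hω : (fun k => ξ i k ω) = fun k => ξ i' k ω := hω
        simp only [Finset.mem_univ, Set.iUnion_true, Set.mem_iUnion]
        exact ⟨fun l => ξ i l ω, fun l => rfl, fun l => (congrFun hω l).symm⟩
      · refine Finset.sum_congr rfl fun w _ => ?_
        have h := hpair.measure_inter_preimage_eq_mul _ _ (measurableSet_wordCylinder w)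
          (measurableSet_wordCylinder w)
        have h' := congrArg ENNReal.toReal h
        rw [ENNReal.toReal_mul] at h'
        have h1 := measureReal_wordCylinder hlaw hind i w
        have h2 := measureReal_wordCylinder hlaw hind i' w
        rw [sq]
        exact h'.trans (congrArg₂ (· * ·) h1 h2)
    have h0 : P.real {ω | (fun k => ξ i k ω) = fun k => ξ i' k ω} = 0 :=
      le_antisymm (ge_of_tendsto' (tendsto_pow_atTop_nhds_zero_of_lt_one (by positivity)
        (sq_add_sq_lt_one hp hq hpq)) hle) measureReal_nonneg
    rw [measureReal_eq_zero_iff] at h0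
    rw [ae_iff]
    simpa using h0
  have hall : ∀ᵐ ω ∂P, ∀ i i', i ≠ i' → (fun k => ξ i k ω) ≠ fun k => ξ i' k ω := by
    simp only [ae_all_iff]
    exact hne
  filter_upwards [hall] with ω hω i i' h
  by_contra hii
  exact hω i i' hii h

end Words

lemma mem_wordCylinder_append {k j : ℕ} (u : Fin k → Bool) (v : Fin j → Bool) (s : BitString) :
    s ∈ wordCylinder (Fin.append u v) ↔ s ∈ wordCylinder u ∧ ∀ l : Fin j, s (k + l) = v l := by
  constructor
  · intro h
    exact ⟨fun l => by simpa using h (Fin.castAdd j l), fun l => by simpa using h (Fin.natAdd k l)⟩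
  · rintro ⟨h1, h2⟩ l
    refine Fin.addCases (fun l => ?_) (fun l => ?_) l
    · simpa using h1 l
    · simpa using h2 l

/-- The condition on the string numbered `i'` in the event that the string numbered `i` is the only
one to share the first `k` letters `u` of the string numbered `0`, and also shares the next `j`
letters `v`. -/
def matchCondition {k j : ℕ} (i : ℕ) (u : Fin k → Bool) (v : Fin j → Bool) (i' : ℕ) :
    Set BitString :=
  if i' = 0 ∨ i' = i then wordCylinder (Fin.append u v) else (wordCylinder u)ᶜ

lemma measurableSet_matchCondition {k j : ℕ} (i : ℕ) (u : Fin k → Bool) (v : Fin j → Bool)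
    (i' : ℕ) : MeasurableSet (matchCondition i u v i') := by
  unfold matchCondition
  split_ifs
  · exact measurableSet_wordCylinder _
  · exact (measurableSet_wordCylinder _).compl

/-- The families of strings with a unique match at the levels `k` and `k + j`, decomposed according
to the matching string and the common letters. -/
lemma uniqueMatch_and_iff_exists_word (x : ℕ → BitString) (n k j : ℕ) :
    UniqueMatch x n k ∧ UniqueMatch x n (k + j) ↔
      ∃ t ∈ Finset.Icc 1 n ×ˢ (Finset.univ : Finset ((Fin k → Bool) × (Fin j → Bool))),
        ∀ i' ∈ Finset.range (n + 1), x i' ∈ matchCondition t.1 t.2.1 t.2.2 i' := by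
  rw [uniqueMatch_and_iff]
  constructor
  · rintro ⟨i, hi, h1, h2⟩
    refine ⟨(i, fun l => x 0 l, fun l => x 0 (k + l)), by simpa using hi, fun i' hi' => ?_⟩
    rw [matchCondition]
    split_ifs with h
    · rw [mem_wordCylinder_append]
      rcases h with rfl | rfl
      · exact ⟨fun l => rfl, fun l => rfl⟩
      · exact ⟨fun l => h1 l (by omega), fun l => h1 (k + l) (by omega)⟩
    · push Not at h
      rw [Finset.mem_range] at hi'
      intro h3
      exact h2 i' ⟨by omega, by omega⟩ h.2 fun l hl => h3 ⟨l, hl⟩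
  · rintro ⟨⟨i, u, v⟩, ht, h⟩
    simp only [Finset.mem_product, Finset.mem_Icc, Finset.mem_univ, and_true] at ht h
    have h0 := h 0 (by simp)
    have hi := h i (Finset.mem_range.2 (by omega))
    rw [matchCondition, if_pos (Or.inl rfl)] at h0
    rw [matchCondition, if_pos (Or.inr rfl)] at hi
    refine ⟨i, ht, fun l hl => (hi ⟨l, hl⟩).trans (h0 ⟨l, hl⟩).symm, fun i' hi' hne h1 => ?_⟩
    have h2 := h i' (Finset.mem_range.2 (by omega))
    rw [matchCondition, if_neg (by omega)] at h2
    exact h2 fun l => (h1 l l.2).trans (((mem_wordCylinder_append u v _).1 h0).1 l)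

/-- String 0 determines both words; a second matching index is impossible since every index other
than 0 and i must avoid the first word. -/
lemma matchCondition_unique {x : ℕ → BitString} {n k j : ℕ}
    {t t' : ℕ × (Fin k → Bool) × (Fin j → Bool)} (ht : t.1 ∈ Finset.Icc 1 n)
    (h : ∀ i' ∈ Finset.range (n + 1), x i' ∈ matchCondition t.1 t.2.1 t.2.2 i')
    (h' : ∀ i' ∈ Finset.range (n + 1), x i' ∈ matchCondition t'.1 t'.2.1 t'.2.2 i') : t = t' := by
  obtain ⟨i, u, v⟩ := t
  obtain ⟨i', u', v'⟩ := t'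
  simp only at *
  rw [Finset.mem_Icc] at ht
  have h0 := h 0 (by simp)
  have h0' := h' 0 (by simp)
  rw [matchCondition, if_pos (Or.inl rfl), mem_wordCylinder_append] at h0 h0'
  have hu : u = u' := funext fun l => (h0.1 l).symm.trans (h0'.1 l)
  have hv : v = v' := funext fun l => (h0.2 l).symm.trans (h0'.2 l)
  subst hu hv
  have hi : i = i' := by
    by_contra hne
    have h1 := h i (Finset.mem_range.2 (by omega))
    have h2 := h' i (Finset.mem_range.2 (by omega))
    rw [matchCondition, if_pos (Or.inr rfl), mem_wordCylinder_append] at h1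
    rw [matchCondition, if_neg (by omega)] at h2
    exact h2 h1.1
  rw [hi]

lemma measurableSet_uniqueMatch (n k : ℕ) :
    MeasurableSet {x : ℕ → BitString | UniqueMatch x n k} := by
  have e : {x : ℕ → BitString | UniqueMatch x n k}
      = ⋃ t ∈ Finset.Icc 1 n ×ˢ (Finset.univ : Finset ((Fin k → Bool) × (Fin 0 → Bool))),
        ⋂ i' ∈ Finset.range (n + 1), (fun x => x i') ⁻¹' matchCondition t.1 t.2.1 t.2.2 i' := by
    ext x
    have h := uniqueMatch_and_iff_exists_word x n k 0
    simp only [add_zero, and_self] at h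
    simp only [Set.mem_ofPred_eq, h, Set.mem_iUnion, Set.mem_iInter, Set.mem_preimage, exists_prop]
  rw [e]
  exact Finset.measurableSet_biUnion _ fun t _ => Finset.measurableSet_biInter _ fun i' _ =>
    measurable_pi_apply i' (measurableSet_matchCondition _ _ _ _)

section UniqueMatchProb

variable {Ω : Type*} [MeasurableSpace Ω] {P : Measure Ω} [IsProbabilityMeasure P] {p q : ℝ}
  {ξ : ℕ → ℕ → Ω → Bool} (hm : ∀ i k, Measurable (ξ i k))
  (hlaw : ∀ i k b, P.real {ω | ξ i k ω = b} = letterProb p q b)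
  (hind : iIndepFun (fun ik : ℕ × ℕ => ξ ik.1 ik.2) P)
include hm hlaw hind

lemma measureReal_matchCondition {n i : ℕ} (hi : i ∈ Finset.Icc 1 n) {k j : ℕ}
    (u : Fin k → Bool) (v : Fin j → Bool) :
    P.real {ω | ∀ i' ∈ Finset.range (n + 1), (fun l => ξ i' l ω) ∈ matchCondition i u v i'}
      = (wordProb p q u * wordProb p q v) ^ 2 * (1 - wordProb p q u) ^ (n - 1) := by
  have hrow : ∀ i, Measurable fun ω k => ξ i k ω := fun i => measurable_pi_iff.2 fun k => hm i k
  have h := (iIndepFun_rows hm hind).measure_inter_preimage_eq_mul (Finset.range (n + 1))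
    (sets := matchCondition i u v) fun i' _ => measurableSet_matchCondition i u v i'
  have e : {ω | ∀ i' ∈ Finset.range (n + 1), (fun l => ξ i' l ω) ∈ matchCondition i u v i'}
      = ⋂ i' ∈ Finset.range (n + 1), (fun ω l => ξ i' l ω) ⁻¹' matchCondition i u v i' := by
    ext ω
    simp
  have hone : ∀ i', P.real ((fun ω l => ξ i' l ω) ⁻¹' matchCondition i u v i')
      = if i' = 0 ∨ i' = i then wordProb p q u * wordProb p q v else 1 - wordProb p q u := by
    intro i'
    rw [matchCondition]
    split_ifs
    · rw [← wordProb_append]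
      exact measureReal_wordCylinder hlaw hind i' _
    · rw [Set.preimage_compl, probReal_compl_eq_one_sub (hrow i' (measurableSet_wordCylinder u))]
      exact congrArg (1 - ·) (measureReal_wordCylinder hlaw hind i' u)
  rw [Finset.mem_Icc] at hi
  have hfilter : (Finset.range (n + 1)).filter (fun i' => i' = 0 ∨ i' = i) = {0, i} := by
    ext i'
    simp only [Finset.mem_filter, Finset.mem_range, Finset.mem_insert, Finset.mem_singleton]
    omega
  have hcard : ((Finset.range (n + 1)).filter fun i' => i' = 0 ∨ i' = i).card = 2 := by
    rw [hfilter, Finset.card_pair (by omega)]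
  have hcard' : ((Finset.range (n + 1)).filter fun i' => ¬ (i' = 0 ∨ i' = i)).card = n - 1 := by
    have := Finset.card_filter_add_card_filter_not (s := Finset.range (n + 1))
      (fun i' => i' = 0 ∨ i' = i)
    rw [hcard, Finset.card_range] at this
    omega
  rw [e, measureReal_def, h, ENNReal.toReal_prod]
  simp only [← measureReal_def, hone]
  rw [Finset.prod_ite, Finset.prod_const, Finset.prod_const, hcard, hcard']

/-- The events with given matching index and common words are disjoint. Summing over the index gives
n, over the last j letters (p² + q²)^j, and over the first k letters the iterated average. -/
lemma measureReal_uniqueMatch_and (n k j : ℕ) :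
    P.real {ω | UniqueMatch (fun i l => ξ i l ω) n k ∧ UniqueMatch (fun i l => ξ i l ω) n (k + j)}
      = (p ^ 2 + q ^ 2) ^ j *
        (average p q)^[k] (fun y => n * (y * (1 - y) ^ (n - 1))) 1 := by
  have hrow : ∀ i, Measurable fun ω k => ξ i k ω := fun i => measurable_pi_iff.2 fun k => hm i k
  have e : {ω | UniqueMatch (fun i l => ξ i l ω) n k ∧ UniqueMatch (fun i l => ξ i l ω) n (k + j)}
      = ⋃ t ∈ Finset.Icc 1 n ×ˢ (Finset.univ : Finset ((Fin k → Bool) × (Fin j → Bool))),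
        {ω | ∀ i' ∈ Finset.range (n + 1),
          (fun l => ξ i' l ω) ∈ matchCondition t.1 t.2.1 t.2.2 i'} := by
    ext ω
    simp only [Set.mem_ofPred_eq, uniqueMatch_and_iff_exists_word, Set.mem_iUnion, exists_prop]
  rw [e, measureReal_biUnion_finset]
  · have h1 : ∀ t ∈ Finset.Icc 1 n ×ˢ (Finset.univ : Finset ((Fin k → Bool) × (Fin j → Bool))),
        P.real {ω | ∀ i' ∈ Finset.range (n + 1),
          (fun l => ξ i' l ω) ∈ matchCondition t.1 t.2.1 t.2.2 i'}
        = (wordProb p q t.2.1 * wordProb p q t.2.2) ^ 2 * (1 - wordProb p q t.2.1) ^ (n - 1) :=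
      fun t ht => measureReal_matchCondition hm hlaw hind (Finset.mem_product.1 ht).1 _ _
    rw [Finset.sum_congr rfl h1, Finset.sum_product]
    dsimp only
    rw [Finset.sum_const, Nat.card_Icc, Nat.add_sub_cancel, nsmul_eq_mul, Fintype.sum_prod_type, average_iterate_const_mul,
      ← sum_wordProb_mul, ← sum_wordProb_sq, mul_left_comm, Finset.sum_mul_sum, Finset.sum_comm]
    congr 1
    refine Finset.sum_congr rfl fun v _ => Finset.sum_congr rfl fun u _ => ?_
    ring
  · intro t ht t' _ hne
    refine Set.disjoint_left.2 fun ω hω hω' => hne ?_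
    exact matchCondition_unique (x := fun i l => ξ i l ω)
      (Finset.mem_product.1 (Finset.mem_coe.1 ht)).1 hω hω'
  · intro t _
    have e2 : {ω | ∀ i' ∈ Finset.range (n + 1),
        (fun l => ξ i' l ω) ∈ matchCondition t.1 t.2.1 t.2.2 i'}
        = ⋂ i' ∈ Finset.range (n + 1),
          (fun ω l => ξ i' l ω) ⁻¹' matchCondition t.1 t.2.1 t.2.2 i' := by
      ext ω
      simp
    rw [e2]
    exact Finset.measurableSet_biInter _ fun i' _ =>
      hrow i' (measurableSet_matchCondition _ _ _ _)

end UniqueMatchProb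

/-! ### The Poisson model -/

/-- This is Poisson thinning: the number of strings with a prefix of probability x is Poisson with
mean λx, and the right side is the probability that it equals 1. -/
lemma hasSum_poisson_mul_binomial (lam x : ℝ) :
    HasSum (fun n : ℕ => Real.exp (-lam) * lam ^ n / n.factorial * (n * (x * (1 - x) ^ (n - 1))))
      (lam * x * Real.exp (-(lam * x))) := by
  rw [← hasSum_nat_add_iff' 1]
  have h := (NormedSpace.expSeries_div_hasSum_exp (lam * (1 - x))).mul_left
    (Real.exp (-lam) * (lam * x))
  rw [← Real.exp_eq_exp_ℝ] at h
  have e : lam * x * Real.exp (-(lam * x)) - ∑ i ∈ Finset.range 1,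
      Real.exp (-lam) * lam ^ i / i.factorial * (i * (x * (1 - x) ^ (i - 1)))
      = Real.exp (-lam) * (lam * x) * Real.exp (lam * (1 - x)) := by
    rw [mul_right_comm (Real.exp (-lam)), ← Real.exp_add, Finset.sum_range_one, Nat.cast_zero,
      zero_mul, mul_zero, sub_zero, mul_comm]
    ring_nf
  rw [e]
  refine h.congr_fun fun n => ?_
  have hn : (n.factorial : ℝ) ≠ 0 := by exact_mod_cast n.factorial_ne_zero
  have hn1 : (n : ℝ) + 1 ≠ 0 := by positivity
  rw [Nat.add_sub_cancel, Nat.factorial_succ, mul_pow]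
  push_cast
  field_simp
  ring

section PoissonModel

variable {Ω : Type*} [MeasurableSpace Ω] {P : Measure Ω} [IsProbabilityMeasure P] {p q : ℝ}
  {ξ : ℕ → ℕ → Ω → Bool} (hm : ∀ i k, Measurable (ξ i k))

include hm in
omit [IsProbabilityMeasure P] in
lemma measurableSet_uniqueMatch_comp {M : Ω → ℕ} (hM : Measurable M) (k : ℕ) :
    MeasurableSet {ω | UniqueMatch (fun i l => ξ i l ω) (M ω) k} := by
  have hx : Measurable fun ω i l => ξ i l ω :=
    measurable_pi_iff.2 fun i => measurable_pi_iff.2 fun l => hm i l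
  have e : {ω | UniqueMatch (fun i l => ξ i l ω) (M ω) k}
      = ⋃ n, M ⁻¹' {n} ∩ (fun ω i l => ξ i l ω) ⁻¹' {x | UniqueMatch x n k} := by
    ext ω
    simp
  rw [e]
  exact MeasurableSet.iUnion fun n => (hM (measurableSet_singleton n)).inter
    (hx (measurableSet_uniqueMatch n k))

variable (hlaw : ∀ i k b, P.real {ω | ξ i k ω = b} = letterProb p q b)
  (hind : iIndepFun (fun ik : ℕ × ℕ => ξ ik.1 ik.2) P)
  (hp : 0 < p) (hq : 0 < q) (hpq : p + q = 1)
include hm hlaw hind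

/-- The event is split by the value of M, which is independent of the strings. An iterated average
is a finite linear combination of values of its kernel, so the Poisson mixture passes into the
kernel. -/
lemma measureReal_uniqueMatch_poisson {lam : ℝ≥0} {M : Ω → ℕ} (hM : Measurable M)
    (hMlaw : P.map M = poissonMeasure lam)
    (hMind : IndepFun M (fun ω (ik : ℕ × ℕ) => ξ ik.1 ik.2 ω) P) (k j : ℕ) :
    P.real ({ω | UniqueMatch (fun i l => ξ i l ω) (M ω) k} ∩
      {ω | UniqueMatch (fun i l => ξ i l ω) (M ω) (k + j)})
      = (p ^ 2 + q ^ 2) ^ j * (average p q)^[k] (fun y => y * Real.exp (-y)) lam := by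
  have hx : Measurable fun ω i l => ξ i l ω :=
    measurable_pi_iff.2 fun i => measurable_pi_iff.2 fun l => hm i l
  set F : ℕ → Set (ℕ → BitString) := fun n => {x | UniqueMatch x n k ∧ UniqueMatch x n (k + j)}
    with hF
  have hFm : ∀ n, MeasurableSet (F n) := fun n =>
    (measurableSet_uniqueMatch n k).inter (measurableSet_uniqueMatch n (k + j))
  have e : {ω | UniqueMatch (fun i l => ξ i l ω) (M ω) k} ∩
      {ω | UniqueMatch (fun i l => ξ i l ω) (M ω) (k + j)}
      = ⋃ n, M ⁻¹' {n} ∩ (fun ω i l => ξ i l ω) ⁻¹' F n := by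
    ext ω
    simp [hF]
  have hMind' : IndepFun M (fun ω i l => ξ i l ω) P :=
    hMind.comp measurable_id (MeasurableEquiv.curry ℕ ℕ Bool).measurable
  have hterm : ∀ n, P (M ⁻¹' {n} ∩ (fun ω i l => ξ i l ω) ⁻¹' F n)
      = ENNReal.ofReal (Real.exp (-lam) * lam ^ n / n.factorial * ((p ^ 2 + q ^ 2) ^ j *
        (average p q)^[k] (fun y => n * (y * (1 - y) ^ (n - 1))) 1)) := by
    intro n
    rw [hMind'.measure_inter_preimage_eq_mul _ _ (measurableSet_singleton n) (hFm n),
      ← Measure.map_apply hM (measurableSet_singleton n), hMlaw, poissonMeasure_singleton,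
      ENNReal.ofReal_mul (by positivity), ← measureReal_uniqueMatch_and hm hlaw hind n k j,
      ofReal_measureReal]
    rfl
  have hsum : HasSum (fun n : ℕ => Real.exp (-lam) * lam ^ n / n.factorial *
      ((p ^ 2 + q ^ 2) ^ j * (average p q)^[k] (fun y => n * (y * (1 - y) ^ (n - 1))) 1))
      ((p ^ 2 + q ^ 2) ^ j * (average p q)^[k] (fun y => y * Real.exp (-y)) lam) := by
    have h := (average_iterate_hasSum (p := p) (q := q)
      (fun x => hasSum_poisson_mul_binomial lam x) k 1).mul_left ((p ^ 2 + q ^ 2) ^ j)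
    rw [average_iterate_comp_mul (h := fun y => y * Real.exp (-y)), mul_one] at h
    refine h.congr_fun fun n => ?_
    rw [average_iterate_const_mul _ fun x => n * (x * (1 - x) ^ (n - 1))]
    ring
  have hnonneg : ∀ n : ℕ, 0 ≤ Real.exp (-lam) * lam ^ n / n.factorial *
      ((p ^ 2 + q ^ 2) ^ j * (average p q)^[k] (fun y => n * (y * (1 - y) ^ (n - 1))) 1) := by
    intro n
    rw [← measureReal_uniqueMatch_and hm hlaw hind n k j]
    positivity
  rw [e, measureReal_def, measure_iUnion]
  · simp only [hterm]
    rw [← ENNReal.ofReal_tsum_of_nonneg hnonneg hsum.summable, hsum.tsum_eq,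
      ENNReal.toReal_ofReal (hsum.nonneg hnonneg)]
  · intro n n' hne
    refine Set.disjoint_left.2 fun ω hω hω' => hne ?_
    exact hω.1.symm.trans hω'.1
  · exact fun n => (hM (measurableSet_singleton n)).inter (hx (hFm n))

include hp hq hpq

lemma hasSum_measureReal_uniqueMatch (n j : ℕ) :
    HasSum (fun k => P.real ({ω | UniqueMatch (fun i l => ξ i l ω) n k} ∩
      {ω | UniqueMatch (fun i l => ξ i l ω) n (k + j)}))
      ((p ^ 2 + q ^ 2) ^ j * fixedMean p q n) :=
  ((summable_average_iterate hp hq hpq zero_le_one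
    fun _ hy hy1 => abs_natCast_mul_pow_le n hy hy1).hasSum.mul_left _).congr_fun
      fun k => measureReal_uniqueMatch_and hm hlaw hind n k j

lemma hasSum_measureReal_uniqueMatch_poisson {lam : ℝ≥0} {M : Ω → ℕ} (hM : Measurable M)
    (hMlaw : P.map M = poissonMeasure lam)
    (hMind : IndepFun M (fun ω (ik : ℕ × ℕ) => ξ ik.1 ik.2 ω) P) (j : ℕ) :
    HasSum (fun k => P.real ({ω | UniqueMatch (fun i l => ξ i l ω) (M ω) k} ∩
      {ω | UniqueMatch (fun i l => ξ i l ω) (M ω) (k + j)}))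
      ((p ^ 2 + q ^ 2) ^ j * poissonMean p q lam) :=
  ((summable_average_iterate hp hq hpq lam.2
    fun _ hy _ => abs_mul_exp_neg_le hy).hasSum.mul_left _).congr_fun
      fun k => measureReal_uniqueMatch_poisson hm hlaw hind hM hMlaw hMind k j

end PoissonModel

end RandomTrie

theorem mainTheorem8 {Ω : Type*} [MeasurableSpace Ω] (P : Measure Ω) [IsProbabilityMeasure P]
    (p q H : ℝ) (hp : 0 < p) (hp1 : p < 1) (hq : q = 1 - p)
    (hH : H = -p * Real.log p - q * Real.log q)
    -- `ξ i k` is the `k`th letter of the `i`th random string; all letters are i.i.d. Bernoulli(p)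
    (ξ : ℕ → ℕ → Ω → Bool)
    (hξ_meas : ∀ i k, Measurable (ξ i k))
    (hξ_law : ∀ i k, P.real {ω | ξ i k ω = true} = p)
    (hξ_indep : iIndepFun (fun ik : ℕ × ℕ => ξ ik.1 ik.2) P)
    -- `M lam` is the Poisson(lam) number of strings in the Poisson model
    (M : ℝ≥0 → Ω → ℕ)
    (hM_meas : ∀ lam, Measurable (M lam))
    (hM_law : ∀ lam, P.map (M lam) = poissonMeasure lam)
    (hM_indep : ∀ lam, IndepFun (M lam) (fun ω (ik : ℕ × ℕ) => ξ ik.1 ik.2 ω) P) :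
    ∃ ψ : ℝ → ℝ, RandomTrie.IsOscillation p q H ψ ∧
      RandomTrie.InsertionAsymptotics P p q H ψ atTop (fun n : ℕ => (n : ℝ))
        (fun n ω => RandomTrie.insertionCount (fun i k => ξ i k ω) n) ∧
      RandomTrie.InsertionAsymptotics P p q H ψ atTop (fun lam : ℝ≥0 => (lam : ℝ))
        (fun lam ω => RandomTrie.insertionCount (fun i k => ξ i k ω) (M lam ω)) := by
  have hq0 : 0 < q := by linarith
  have hpq : p + q = 1 := by linarith
  have hlaw : ∀ i k b, P.real {ω | ξ i k ω = b} = RandomTrie.letterProb p q b := by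
    intro i k b
    cases b with
    | true => exact hξ_law i k
    | false =>
      have hs : MeasurableSet {ω | ξ i k ω = true} := hξ_meas i k (measurableSet_singleton true)
      have e : {ω | ξ i k ω = false} = {ω | ξ i k ω = true}ᶜ := by
        ext ω
        simp
      rw [e, probReal_compl_eq_one_sub hs, hξ_law, RandomTrie.letterProb, hq]
      rfl
  obtain ⟨ψ, hψ, hlim⟩ := RandomTrie.exists_isOscillation_tendsto_poissonMean hp hq0 hpq hH
  have hinj := RandomTrie.ae_injective_rows hξ_meas hlaw hξ_indep hp hq0 hpq
  refine ⟨ψ, hψ, ?_, ?_⟩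
  · refine RandomTrie.insertionAsymptotics_of_mean hp hq0 hpq
      (E := fun n k => {ω | RandomTrie.UniqueMatch (fun i l => ξ i l ω) n k})
      (a := RandomTrie.fixedMean p q)
      (fun n k => RandomTrie.measurableSet_uniqueMatch_comp hξ_meas measurable_const k)
      (fun n => ?_) (fun n => ?_)
      (RandomTrie.hasSum_measureReal_uniqueMatch hξ_meas hlaw hξ_indep hp hq0 hpq) ?_
    · filter_upwards [hinj] with ω hω
      exact ⟨RandomTrie.insertionCount_eq_ncard hω n, RandomTrie.finite_uniqueMatch hω n,
        RandomTrie.ordConnected_uniqueMatch _ n⟩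
    · have h := RandomTrie.hasSum_measureReal_uniqueMatch hξ_meas hlaw hξ_indep hp hq0 hpq n 0
      rw [pow_zero, one_mul] at h
      exact h.nonneg fun k => measureReal_nonneg
    -- Depoissonization transfers the asymptotics of the Poisson mean along the integers.
    · have h := (RandomTrie.tendsto_fixedMean_sub_poissonMean hp hq0 hpq).add
        (hlim.comp tendsto_natCast_atTop_atTop)
      rw [add_zero] at h
      exact h.congr fun n => sub_add_sub_cancel _ _ _
  · refine RandomTrie.insertionAsymptotics_of_mean hp hq0 hpq
      (E := fun lam k => {ω | RandomTrie.UniqueMatch (fun i l => ξ i l ω) (M lam ω) k})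
      (a := fun lam => RandomTrie.poissonMean p q lam)
      (fun lam k => RandomTrie.measurableSet_uniqueMatch_comp hξ_meas (hM_meas lam) k)
      (fun lam => ?_) (fun lam => RandomTrie.poissonMean_nonneg hp hq0 hpq lam.2)
      (fun lam j => RandomTrie.hasSum_measureReal_uniqueMatch_poisson hξ_meas hlaw hξ_indep hp hq0
        hpq (hM_meas lam) (hM_law lam) (hM_indep lam) j)
      (hlim.comp (NNReal.tendsto_coe_atTop.2 tendsto_id))
    filter_upwards [hinj] with ω hω
    exact ⟨RandomTrie.insertionCount_eq_ncard hω _, RandomTrie.finite_uniqueMatch hω _,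
      RandomTrie.ordConnected_uniqueMatch _ _⟩
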